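/- **Setting.** Let $1\le t\le T\le d$ be integers. In a linear contextual bandit with $K$ arms and horizon $T$, contexts $x_i(\tau)\in\mathbb R^d$ ($i\in[K]$, $\tau\in[T]$) are revealed in round $\tau$; for each $i$ the $x_i(\tau)$, $\tau\in[T]$, are i.i.d. from $\mathcal P_i$. An arm $a_\tau$ is chosen and $r(\tau)=x_{a_\tau}(\tau)^\top\beta^*+\epsilon(\tau)$ is observed. The $\epsilon(\tau)$ are independent, independent of all other sources of randomness (contexts and randomisation of the policy), and $\sigma$-sub-Gaussian: $\mathbb E e^{a\epsilon(\tau)}\le e^{\sigma^2a^2/2}$ for all $a\in\mathbb R$, where $\sigma>0$. The policy is an arbitrary admissible one (for instance Thompson sampling): $a_\tau$ is measurable with respect to the $\sigma$-algebra generated by the previously chosen contexts, the previous rewards, the contexts $x_i(\tau)$, $i\in[K]$, of the current round, and an auxiliary randomisation variable; these variables are independent over the rounds and independent of contexts and noise. Put $X_t=(x_{a_1}(1),\dots,x_{a_t}(t))^\top$, $\mathbf r_t=(r(1),\dots,r(t))^\top$, $\epsilon_t=(\epsilon(1),\dots,\epsilon(t))^\top$, $\widehat\Sigma_t=X_t^\top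 X_t/t$. **Assumptions.** Let $x_{\max},\vartheta,\xi,\Delta_*,A>0$, $C>2$, $\phi_u\in\mathbb R$, $\omega\in[0,\infty]$. For a symmetric matrix $M$ and real $s$, let $\phi_{\min}(s;M)$ and $\phi_{\max}(s;M)$ be the infimum and the supremum of $\delta^\top M\delta/\|\delta\|_2^2$ over $\delta\ne0$ with $\|\delta\|_0\le s$. (1) For every $i$: $\|x\|_\infty\le x_{\max}$ $\mathcal P_i$-a.s.; $\mathbb E_{\mathcal P_i}e^{au^\top x}\le e^{\vartheta^2a^2/2}$ for all $a\in\mathbb R$ and $\|u\|_2=1$; $\phi_{\max}(Cs^*;\mathbb E_{\mathcal P_i}xx^\top)\le\phi_u$. (2) $\|\beta^*\|_0=s^*\ge1$, $\|\beta^*\|_1\le b_{\max}$, and, with $a^*_\tau$ an optimal arm of round $\tau$, $\mathbb P\big(x_{a^*_\tau}(\tau)^\top\beta^*\le\max_{i\ne a^*_\tau}x_i(\tau)^\top\beta^*+h\big)\le(h/\Delta_*)^\omega$ for all $\tau\in[T]$ and $h\in[A\sqrt{\log d/T},\Delta_*]$. Let $S^*=\{j:\beta^*_j\ne0\}$. **Prior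 and posterior.** The prior $\Pi$ draws a size $s\in\{0,\dots,d\}$ from $\pi_d$, then a uniformly random $S\subset[d]$ with $|S|=s$, then independent $\beta_j$, $j\in S$, with density $\frac{\lambda}{2\sigma}e^{-\lambda|\beta_j|/\sigma}$, and sets $\beta_j=0$ for $j\notin S$. Here $A_1d^{-A_3}\pi_d(s-1)\le\pi_d(s)\le A_2d^{-A_4}\pi_d(s-1)$ for $1\le s\le d$, with constants $A_1,A_2,A_3,A_4>0$, and $$\tfrac53\overline\lambda_t\le\lambda\le2\overline\lambda_t,\qquad\overline\lambda_t=x_{\max}\sqrt{2t(\log d+\log t)}.$$ The posterior comes from the (in general misspecified) likelihood with i.i.d. $\mathsf N(0,\sigma^2)$ errors: $$\Pi^X_t(B\mid\mathbf r_t)=\frac{\int_Be^{-\|\mathbf r_t-X_t\beta\|_2^2/(2\sigma^2)}\,d\Pi(\beta)}{\int e^{-\|\mathbf r_t-X_t\beta\|_2^2/(2\sigma^2)}\,d\Pi(\beta)}.$$ **Events.** Let $\mathbb C_7(S)=\{\delta:\|\delta_{S^c}\|_1\le7\|\delta_S\|_1,\ \delta_S\ne0\}$, $$\phi_{\rm comp}(S;X_t)=\inf_{\delta\in\mathbb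 C_7(S)}\frac{\|X_t\delta\|_2|S|^{1/2}}{t^{1/2}\|\delta\|_1},\qquad\Psi(S;\widehat\Sigma_t)=|S|\inf_{\delta\in\mathbb C_7(S)}\frac{\delta^\top\widehat\Sigma_t\delta}{\|\delta\|_1^2},$$ and let $\widetilde\psi_t(S)$ be the infimum of $\|X_t\delta\|_2/(t^{1/2}\|\delta\|_2)$ over $\delta\ne0$ with $\|\delta\|_0\le\big(2+\frac{40}{A_4}+\frac{128x_{\max}^2}{A_4\Psi(S;\widehat\Sigma_t)}\big)|S|$. For arbitrary constants $c_9,\tilde c,C_1>0$ put $\varepsilon=\min\{1/4,\,1/(\tilde c\phi_u\vartheta^2\xi K\log K+3)\}$, and let $\mathcal G_t$ be the event that $$\phi_{\max}(Cs^*;\widehat\Sigma_t)\le\tfrac{c_9\vartheta^2\phi_u\log K}{1-3\varepsilon},\quad\phi_{\min}(Cs^*;\widehat\Sigma_t)\ge\tfrac1{8K\xi},\quad\Psi(S^*;\widehat\Sigma_t)\ge\tfrac1{C_1\xi K},\quad\widetilde\psi_t(S^*)^2\ge\tfrac1{8K\xi}.$$ Let $\mathcal T_t$ be the event that $\max_j|\epsilon_t^\top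 X_t^{(j)}|/t\le x_{\max}\sigma\sqrt{(2\log t+2\log d)/t}$, where $X_t^{(j)}$ is the $j$-th column of $X_t$. Finally let $$D_*=\Big(1+\frac{40}{A_4}\Big)s^*+\frac{128\,x_{\max}^2s^*}{A_4\,\phi_{\rm comp}^2(S^*;X_t)}.$$ **Theorem.** There are constants $Q,M>0$ depending only on $A_1,A_2,A_3,A_4$ such that in every setting as above, for almost every realisation of $X_t$, $$\mathbb E\Big[\Pi^X_t\Big(\|\beta-\beta^*\|_1\ge Q\,\sigma x_{\max}K\xi\,(D_*+s^*)\sqrt{\tfrac{\log d+\log t}{t}}\ \Big|\ \mathbf r_t\Big)\mathbf 1_{\mathcal G_t\cap\mathcal T_t}\ \Big|\ X_t\Big]\le M\,d^{-s^*},$$ the expectation being over the true conditional distribution of $\mathbf r_t$ given $X_t$. -/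

import Mathlib

open MeasureTheory ProbabilityTheory
open scoped ENNReal

noncomputable section

namespace SparseBandit

/-! ### Vectors, sparse eigenvalues and compatibility numbers -/

/-- Vectors in `ℝ^d`, with the product σ-algebra. -/
abbrev Vec (d : ℕ) := Fin d → ℝ

/-- Design matrices with `t` rows in `ℝ^d`, with the product σ-algebra. -/
abbrev Design (t d : ℕ) := Fin t → Vec d

/-- The `ℓ₁` norm. -/
def l1 {n : ℕ} (v : Vec n) : ℝ := ∑ j, |v j|

/-- The `ℓ₂` norm. -/
def l2 {n : ℕ} (v : Vec n) : ℝ := Real.sqrt (∑ j, v j ^ 2)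

/-- The support of a vector. -/
def supp {n : ℕ} (v : Vec n) : Finset (Fin n) := Finset.univ.filter fun j => v j ≠ 0

/-- The number of nonzero coordinates, `‖v‖₀`. -/
def l0 {n : ℕ} (v : Vec n) : ℕ := (supp v).card

/-- The inner product of `ℝ^n`. -/
def dot {n : ℕ} (u v : Vec n) : ℝ := ∑ j, u j * v j

/-- The matrix-vector product `X v`. -/
def app {t d : ℕ} (X : Design t d) (v : Vec d) : Vec t := fun i => dot (X i) v

/-- The empirical second moment matrix `Xᵀ X / t`. -/
def gram {t d : ℕ} (X : Design t d) : Matrix (Fin d) (Fin d) ℝ :=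
  Matrix.of fun j k => (∑ i, X i j * X i k) / (t : ℝ)

/-- The second moment matrix `E[x xᵀ]` of a distribution on `ℝ^d`. -/
def secondMoment {d : ℕ} (P : Measure (Vec d)) : Matrix (Fin d) (Fin d) ℝ :=
  Matrix.of fun j k => ∫ x, x j * x k ∂P

/-- The quadratic form `vᵀ M v`. -/
def quad {d : ℕ} (M : Matrix (Fin d) (Fin d) ℝ) (v : Vec d) : ℝ :=
  ∑ j, ∑ k, v j * M j k * v k

/-- The minimum sparse eigenvalue `φ_min(s; M)`, with a real sparsity level. -/
def phiMin {d : ℕ} (s : ℝ) (M : Matrix (Fin d) (Fin d) ℝ) : ℝ :=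
  ⨅ δ : {δ : Vec d // δ ≠ 0 ∧ (l0 δ : ℝ) ≤ s}, quad M δ.1 / l2 δ.1 ^ 2

/-- The maximum sparse eigenvalue `φ_max(s; M)`, with a real sparsity level. -/
def phiMax {d : ℕ} (s : ℝ) (M : Matrix (Fin d) (Fin d) ℝ) : ℝ :=
  ⨆ δ : {δ : Vec d // δ ≠ 0 ∧ (l0 δ : ℝ) ≤ s}, quad M δ.1 / l2 δ.1 ^ 2

/-- The restricted cone `{v : ‖v_{Iᶜ}‖₁ ≤ α ‖v_I‖₁, v_I ≠ 0}`. -/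
def cone {d : ℕ} (α : ℝ) (I : Finset (Fin d)) : Set (Vec d) :=
  {v | ∑ j ∈ Iᶜ, |v j| ≤ α * ∑ j ∈ I, |v j| ∧ ∃ j ∈ I, v j ≠ 0}

/-- The compatibility number `φ_comp(S; X)`. -/
def phiComp {t d : ℕ} (S : Finset (Fin d)) (X : Design t d) : ℝ :=
  ⨅ δ : cone 7 S, l2 (app X δ.1) * Real.sqrt (S.card : ℝ) / (Real.sqrt (t : ℝ) * l1 δ.1)

/-- The compatibility number `Ψ(S; M)` of a matrix. -/
def Psi {d : ℕ} (S : Finset (Fin d)) (M : Matrix (Fin d) (Fin d) ℝ) : ℝ :=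
  (⨅ δ : cone 7 S, quad M δ.1 / l1 δ.1 ^ 2) * (S.card : ℝ)

/-- The uniform `ℓ₂` compatibility number over vectors of sparsity at most `s`. -/
def phiTilde {t d : ℕ} (X : Design t d) (s : ℝ) : ℝ :=
  ⨅ δ : {δ : Vec d // δ ≠ 0 ∧ (l0 δ : ℝ) ≤ s},
    l2 (app X δ.1) / (Real.sqrt (t : ℝ) * l2 δ.1)

/-- The number `ψ̃_t(S)`: `phiTilde` at sparsity `(2 + 40/A₄ + 128 x_max² / (A₄ Ψ)) |S|`. -/
def psiTilde {t d : ℕ} (A₄ xmax : ℝ) (S : Finset (Fin d)) (X : Design t d) : ℝ :=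
  phiTilde X ((2 + 40 / A₄ + 128 / A₄ * xmax ^ 2 / Psi S (gram X)) * (S.card : ℝ))

/-- The effective dimension `D_*`. -/
def Dstar {t d : ℕ} (A₄ xmax : ℝ) (S : Finset (Fin d)) (X : Design t d) : ℝ :=
  (1 + 40 / A₄) * (S.card : ℝ) + 128 / A₄ * xmax ^ 2 * (S.card : ℝ) / phiComp S X ^ 2

/-- The event `𝒢_t` on the design matrix: sparse eigenvalue bounds at level `C |S|`,
the compatibility bound, and the uniform compatibility bound. -/
def goodDesign {t d : ℕ} (K : ℕ) (A₄ xmax ξ ϑ φu C c₉ cε C₁ : ℝ) (S : Finset (Fin d)) :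
    Set (Design t d) :=
  let eps : ℝ := min (1 / 4) (1 / (cε * φu * ϑ ^ 2 * ξ * K * Real.log K + 3))
  {X | phiMax (C * S.card) (gram X) ≤ c₉ * ϑ ^ 2 * φu * Real.log K / (1 - 3 * eps) ∧
    1 / (8 * K * ξ) ≤ phiMin (C * S.card) (gram X) ∧
    1 / (C₁ * ξ * K) ≤ Psi S (gram X) ∧
    1 / (8 * K * ξ) ≤ psiTilde A₄ xmax S X ^ 2}

/-- The event `𝒯_t(λ₀(γ_t))`, `γ_t = √(2 log t)`, for a noise vector and a design matrix. -/
def NoiseControlled {t d : ℕ} (σ xmax : ℝ) (e : Vec t) (X : Design t d) : Prop :=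
  ∀ j, |∑ i, e i * X i j| / (t : ℝ) ≤
    xmax * σ * Real.sqrt ((Real.sqrt (2 * Real.log t) ^ 2 + 2 * Real.log d) / t)

/-! ### Prior and posterior -/

/-- The Laplace distribution with density `(b/2) exp(-b|x|)`. -/
def laplace (b : ℝ) : Measure ℝ :=
  volume.withDensity fun x => ENNReal.ofReal (b / 2 * Real.exp (-b * |x|))

/-- Given the model `S`: independent Laplace coordinates on `S`, zeros off `S`. -/
def slab {d : ℕ} (b : ℝ) (S : Finset (Fin d)) : Measure (Vec d) :=
  Measure.pi fun j => if j ∈ S then laplace b else Measure.dirac 0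

/-- The complexity prior: `|S| ∼ w`, `S` uniform given its size, then `slab b S`. -/
def complexityPrior (d : ℕ) (w : ℕ → ℝ) (b : ℝ) : Measure (Vec d) :=
  ∑ S : Finset (Fin d), ENNReal.ofReal (w S.card / (d.choose S.card : ℝ)) • slab b S

/-- `w` is a probability on `{0, …, d}` with
`A₁ d^{-A₃} w(s-1) ≤ w(s) ≤ A₂ d^{-A₄} w(s-1)` for `1 ≤ s ≤ d`. -/
structure IsSparsityPrior (d : ℕ) (A₁ A₂ A₃ A₄ : ℝ) (w : ℕ → ℝ) : Prop where
  nonneg : ∀ s, s ≤ d → 0 ≤ w s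
  sum_eq : ∑ s ∈ Finset.range (d + 1), w s = 1
  lower : ∀ s, 1 ≤ s → s ≤ d → A₁ * (d : ℝ) ^ (-A₃) * w (s - 1) ≤ w s
  upper : ∀ s, 1 ≤ s → s ≤ d → w s ≤ A₂ * (d : ℝ) ^ (-A₄) * w (s - 1)

/-- The modelling likelihood: `r = X β + e` with i.i.d. `N(0, σ²)` entries of `e`. -/
def likelihood {t d : ℕ} (σ : ℝ) (X : Design t d) (r : Vec t) (β : Vec d) : ℝ≥0∞ :=
  ∏ i, gaussianPDF (app X β i) (Real.toNNReal (σ ^ 2)) (r i)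

/-- The posterior: prior reweighted by the Gaussian likelihood, and normalised. -/
def posterior {t d : ℕ} (prior : Measure (Vec d)) (σ : ℝ) (X : Design t d) (r : Vec t) :
    Measure (Vec d) :=
  (∫⁻ β, likelihood σ X r β ∂prior)⁻¹ • prior.withDensity (likelihood σ X r)

/-- `λ̄_t = x_max √(2 t (log d + log t))`. -/
def lamBar (xmax : ℝ) (t d : ℕ) : ℝ :=
  xmax * Real.sqrt (2 * t * (Real.log d + Real.log t))

/-! ### The bandit environment -/

/-- Boundedness, sub-Gaussianity and maximum sparse eigenvalue bound for the context
distributions `P i`. -/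
structure ContextAssumptions {d K : ℕ} (P : Fin K → Measure (Vec d)) (xmax ϑ φu : ℝ)
    (s : ℝ) : Prop where
  bounded : ∀ i, ∀ᵐ x ∂P i, ∀ j, |x j| ≤ xmax
  subgaussian : ∀ i, ∀ u : Vec d, l2 u = 1 →
    HasSubgaussianMGF (fun x => dot u x) (Real.toNNReal (ϑ ^ 2)) (P i)
  eigenvalue : ∀ i, phiMax s (secondMoment (P i)) ≤ φu

/-- `q ^ ω` for `q ∈ [0, 1]` and `ω ∈ [0, ∞]`. -/
def powTop (q : ℝ) (ω : ℝ≥0∞) : ℝ :=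
  if ω = ⊤ then (if q < 1 then 0 else 1) else q ^ ω.toReal

variable {Ω : Type*}

/-- The margin condition with constants `Δ`, `A`, `ω` over the horizon `T`.  The event says that
some best arm `k` beats some other arm `i` by at most `h`. -/
def MarginCondition {d K T : ℕ} [MeasurableSpace Ω] (μ : Measure Ω) (βs : Vec d)
    (x : Fin T → Fin K → Ω → Vec d) (Δ A : ℝ) (ω : ℝ≥0∞) : Prop :=
  ∀ h : ℝ, A * Real.sqrt (Real.log d / T) ≤ h → h ≤ Δ → ∀ τ : Fin T,
    μ.real {o | ∃ k, (∀ l, dot (x τ l o) βs ≤ dot (x τ k o) βs) ∧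
      ∃ i, i ≠ k ∧ dot (x τ k o) βs ≤ dot (x τ i o) βs + h} ≤ powTop (h / Δ) ω

/-- The context of the arm chosen in round `τ`. -/
def chosen {d K T : ℕ} (x : Fin T → Fin K → Ω → Vec d) (a : Fin T → Ω → Fin K) (τ : Fin T)
    (o : Ω) : Vec d := x τ (a τ o) o

/-- The reward `r(τ) = x_{a_τ}(τ)ᵀ β* + ε(τ)`. -/
def reward {d K T : ℕ} (βs : Vec d) (x : Fin T → Fin K → Ω → Vec d) (a : Fin T → Ω → Fin K)
    (ε : Fin T → Ω → ℝ) (τ : Fin T) (o : Ω) : ℝ := dot (chosen x a τ o) βs + ε τ o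

/-- What the learner may use in round `τ`: chosen contexts and rewards of the earlier rounds,
all contexts of round `τ`, and a private randomisation variable `U τ`. -/
abbrev info {d K T : ℕ} {V : Type*} [MeasurableSpace V] (βs : Vec d)
    (x : Fin T → Fin K → Ω → Vec d) (a : Fin T → Ω → Fin K) (ε : Fin T → Ω → ℝ)
    (U : Fin T → Ω → V) (τ : Fin T) : MeasurableSpace Ω :=
  (⨆ ρ : {ρ : Fin T // ρ < τ},
      MeasurableSpace.comap (chosen x a ρ.1) inferInstance ⊔
      MeasurableSpace.comap (reward βs x a ε ρ.1) inferInstance) ⊔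
    (⨆ i, MeasurableSpace.comap (x τ i) inferInstance) ⊔
    MeasurableSpace.comap (U τ) inferInstance

/-- A sparse linear contextual bandit over `T` rounds, with parameter `βs`, context distributions
`P i`, independent `σ`-sub-Gaussian noise, and actions chosen by an admissible randomised policy. -/
structure IsBandit {d K T : ℕ} {V : Type*} [MeasurableSpace V] [MeasurableSpace Ω]
    (μ : Measure Ω) (βs : Vec d) (σ : ℝ) (P : Fin K → Measure (Vec d))
    (x : Fin T → Fin K → Ω → Vec d) (ε : Fin T → Ω → ℝ) (U : Fin T → Ω → V)
    (a : Fin T → Ω → Fin K) : Prop where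
  measurable_x : ∀ τ i, Measurable (x τ i)
  measurable_ε : ∀ τ, Measurable (ε τ)
  measurable_U : ∀ τ, Measurable (U τ)
  law_x : ∀ τ i, μ.map (x τ i) = P i
  indep_x : ∀ i, iIndepFun (fun τ => x τ i) μ
  indep_ε : iIndepFun ε μ
  subgaussian_ε : ∀ τ, HasSubgaussianMGF (ε τ) (Real.toNNReal (σ ^ 2)) μ
  indep_U : iIndepFun U μ
  indep_ε_xU : IndepFun (fun o τ => ε τ o) (fun o => (fun τ i => x τ i o, fun τ => U τ o)) μ
  indep_x_U : IndepFun (fun o τ i => x τ i o) (fun o τ => U τ o) μ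
  adapted : ∀ τ, Measurable[info βs x a ε U τ] (a τ)

/-- The matrix `X_t` of the contexts chosen in the first `t` rounds. -/
def designUpTo {d K T : ℕ} (x : Fin T → Fin K → Ω → Vec d) (a : Fin T → Ω → Fin K) {t : ℕ}
    (ht : t ≤ T) (o : Ω) : Design t d := fun i => chosen x a (Fin.castLE ht i) o

/-- The vector of the rewards of the first `t` rounds. -/
def rewardsUpTo {d K T : ℕ} (βs : Vec d) (x : Fin T → Fin K → Ω → Vec d)
    (a : Fin T → Ω → Fin K) (ε : Fin T → Ω → ℝ) {t : ℕ} (ht : t ≤ T) (o : Ω) : Vec t :=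
  fun i => reward βs x a ε (Fin.castLE ht i) o

/-- The `ℓ₁` contraction radius
`Q σ x_max K ξ (D_* + |S|) √((log d + log t) / t)`. -/
def radius {t d : ℕ} (Q σ xmax : ℝ) (K : ℕ) (ξ A₄ : ℝ) (S : Finset (Fin d))
    (X : Design t d) : ℝ :=
  Q * σ * xmax * K * ξ * (Dstar A₄ xmax S X + S.card) *
    Real.sqrt ((Real.log d + Real.log t) / t)

open Classical in
/-- Posterior mass outside the ball around `βs`, times the indicator of `𝒢_t ∩ 𝒯_t`.
The noise vector is `r - X βs`. -/
def outsideMass {t d : ℕ} (prior : Measure (Vec d)) (βs : Vec d) (σ xmax R : ℝ)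
    (G : Set (Design t d)) (X : Design t d) (r : Vec t) : ℝ≥0∞ :=
  if X ∈ G ∧ NoiseControlled σ xmax (fun i => r i - app X βs i) X then
    posterior prior σ X r {β | R ≤ l1 (fun j => β j - βs j)}
  else 0

end SparseBandit

end

/-!
The event `𝒯_t` bounds the noise only through the coordinates of `Xᵀ e`, and the posterior is a
function of the design `X` and the rewards. So the bound holds for every reward vector on
`𝒢_t ∩ 𝒯_t`, for every design with entries bounded by `xmax`, and its conditional expectation
inherits it (`posterior_far_le`, `ae_abs_designUpTo_le`). In particular, the dependence of the
design on past noise does not matter.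

For a fixed design write `v = β - βs`, `s = |S*|`, and `b = lam / σ` for the Laplace parameter, and
compare likelihoods with that of `βs`.

* The denominator of the posterior is at least the contribution of the `ℓ₁` ball of radius `1 / b`
  around `βs` inside the true model (`slab_ball_ge`, `neg_le_logRatio`). This costs at most a factor
  `d ^ (c s)` besides `w s` and `exp (-b ‖βs‖₁)`.
* In the numerator the noise term is at most `(3 / 5) b ‖v‖₁`, by `5 / 3 * lamBar ≤ lam`.
  Together with the Laplace penalty it exceeds the needed `-(b / 10) ‖v‖₁` by at most
  `b (17 / 10 ‖v_S‖₁ - 3 / 10 ‖v_Sᶜ‖₁)`. This is nonpositive outside the cone of aperture `7`, and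
  inside the cone the quadratic term absorbs it up to `24 xmax² s log d / φ_comp²`
  (`logRatio_add_le_of_phiComp`). The remaining `exp (-(b / 10) ‖v‖₁)` integrates to `10` per
  coordinate against the Laplace density (`lintegral_slab_exp_le`).
* Models of size above `D_*` are therefore negligible: the decay of the weights `w` beyond `s`
  beats that exponent and all factors `d ^ (c s)`.
* If `β` has at most `D_*` nonzero coordinates, `v` has at most `D_* + s`, so `psiTilde` applies to
  it without a cone condition. Once `‖v‖₁` exceeds the radius, the quadratic term beats noise and
  penalty by any prescribed multiple of `(D_* + s) log d` (`logRatio_add_le_of_sparse`). Here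
  `K ξ xmax² ≥ 1 / 8`, seen by testing `psiTilde` on a coordinate vector, keeps the radius from
  being too small.

`posterior_le` assembles numerator and denominator, and `weight_mul_exp_le` does the bookkeeping
over model sizes. The comparisons with `A₁`, `A₂`, `A₄` need `d` large; the finitely many smaller
dimensions are absorbed in the constant `M`.
-/

namespace SparseBandit

/-! ### Norms, sparse eigenvalues and compatibility numbers -/

lemma l1_nonneg {n : ℕ} (v : Vec n) : 0 ≤ l1 v := Finset.sum_nonneg fun _ _ => abs_nonneg _

lemma l2_nonneg {n : ℕ} (v : Vec n) : 0 ≤ l2 v := Real.sqrt_nonneg _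

lemma l2_sq {n : ℕ} (v : Vec n) : l2 v ^ 2 = ∑ j, v j ^ 2 :=
  Real.sq_sqrt (Finset.sum_nonneg fun _ _ => sq_nonneg _)

lemma l1_eq_sum_supp {n : ℕ} (v : Vec n) : l1 v = ∑ j ∈ supp v, |v j| := by
  unfold l1 supp
  rw [Finset.sum_filter]
  refine Finset.sum_congr rfl fun j _ => ?_
  by_cases h : v j = 0 <;> simp [h]

lemma l1_sq_le {n : ℕ} (v : Vec n) : l1 v ^ 2 ≤ l0 v * l2 v ^ 2 := by
  rw [l1_eq_sum_supp, l2_sq, l0]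
  refine (sq_sum_le_card_mul_sum_sq (s := supp v) (f := fun j => |v j|)).trans ?_
  refine mul_le_mul_of_nonneg_left ?_ (Nat.cast_nonneg _)
  simp only [sq_abs]
  exact Finset.sum_le_univ_sum_of_nonneg fun _ => sq_nonneg _

lemma app_sub {t d : ℕ} (X : Design t d) (u v : Vec d) (i : Fin t) :
    app X (fun j => u j - v j) i = app X u i - app X v i := by
  simp [app, dot, mul_sub, Finset.sum_sub_distrib]

lemma quad_gram {t d : ℕ} (X : Design t d) (v : Vec d) :
    quad (gram X) v = l2 (app X v) ^ 2 / t := by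
  rw [l2_sq]
  simp only [quad, gram, app, dot, Matrix.of_apply, sq, Finset.sum_div, Finset.sum_mul,
    Finset.mul_sum]
  rw [Finset.sum_comm (s := (Finset.univ : Finset (Fin t)))]
  refine Finset.sum_congr rfl fun j _ => ?_
  rw [Finset.sum_comm]
  refine Finset.sum_congr rfl fun i _ => Finset.sum_congr rfl fun k _ => ?_
  ring

lemma phiComp_nonneg {t d : ℕ} (S : Finset (Fin d)) (X : Design t d) : 0 ≤ phiComp S X :=
  Real.iInf_nonneg fun _ => div_nonneg (mul_nonneg (l2_nonneg _) (Real.sqrt_nonneg _))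
    (mul_nonneg (Real.sqrt_nonneg _) (l1_nonneg _))

lemma phiComp_sq_mul_le {t d : ℕ} {S : Finset (Fin d)} (X : Design t d) {v : Vec d}
    (hv : v ∈ cone 7 S) :
    phiComp S X ^ 2 * (t * l1 v ^ 2) ≤ l2 (app X v) ^ 2 * S.card := by
  have h : phiComp S X ≤ l2 (app X v) * Real.sqrt (S.card : ℝ) / (Real.sqrt (t : ℝ) * l1 v) :=
    ciInf_le (f := fun δ : cone 7 S =>
      l2 (app X δ.1) * Real.sqrt (S.card : ℝ) / (Real.sqrt (t : ℝ) * l1 δ.1))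
      ⟨0, by
        rintro _ ⟨δ, rfl⟩
        exact div_nonneg (mul_nonneg (l2_nonneg _) (Real.sqrt_nonneg _))
          (mul_nonneg (Real.sqrt_nonneg _) (l1_nonneg _))⟩ ⟨v, hv⟩
  have h2 := mul_le_of_le_div₀ (mul_nonneg (l2_nonneg _) (Real.sqrt_nonneg _))
    (mul_nonneg (Real.sqrt_nonneg _) (l1_nonneg _)) h
  have h3 := pow_le_pow_left₀ (mul_nonneg (phiComp_nonneg S X)
    (mul_nonneg (Real.sqrt_nonneg _) (l1_nonneg _))) h2 2
  simpa only [mul_pow, Real.sq_sqrt (Nat.cast_nonneg (α := ℝ) _)] using h3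

lemma single_mem_cone {d : ℕ} {S : Finset (Fin d)} {j : Fin d} (hj : j ∈ S) :
    Pi.single j (1 : ℝ) ∈ cone 7 S := by
  refine ⟨?_, j, hj, by simp⟩
  rw [Finset.sum_eq_zero]
  · exact mul_nonneg (by norm_num) (Finset.sum_nonneg fun _ _ => abs_nonneg _)
  · intro k hk
    have : k ≠ j := by rintro rfl; exact (Finset.mem_compl.1 hk) hj
    simp [this]

/-- The two compatibility numbers agree; only this inequality is needed. -/
lemma Psi_le_phiComp_sq {t d : ℕ} {S : Finset (Fin d)} (hS : S.Nonempty) (X : Design t d) :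
    Psi S (gram X) ≤ phiComp S X ^ 2 := by
  obtain ⟨j, hj⟩ := hS
  have : Nonempty (cone 7 S) := ⟨⟨_, single_mem_cone hj⟩⟩
  have hle : Real.sqrt (Psi S (gram X)) ≤ phiComp S X := by
    refine le_ciInf fun δ => Real.sqrt_le_iff.2 ⟨div_nonneg (mul_nonneg (l2_nonneg _)
      (Real.sqrt_nonneg _)) (mul_nonneg (Real.sqrt_nonneg _) (l1_nonneg _)), ?_⟩
    have h : (⨅ δ : cone 7 S, quad (gram X) δ.1 / l1 δ.1 ^ 2) ≤ quad (gram X) δ.1 / l1 δ.1 ^ 2 :=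
      ciInf_le ⟨0, by
        rintro _ ⟨δ, rfl⟩
        simp only [quad_gram]
        positivity⟩ δ
    refine (mul_le_mul_of_nonneg_right h (Nat.cast_nonneg _)).trans (le_of_eq ?_)
    rw [quad_gram, div_pow, mul_pow, mul_pow, Real.sq_sqrt (Nat.cast_nonneg _),
      Real.sq_sqrt (Nat.cast_nonneg _)]
    ring
  exact (Real.sqrt_le_left (phiComp_nonneg S X)).1 hle

lemma phiTilde_nonneg {t d : ℕ} (X : Design t d) (s : ℝ) : 0 ≤ phiTilde X s :=
  Real.iInf_nonneg fun _ => div_nonneg (l2_nonneg _) (mul_nonneg (Real.sqrt_nonneg _) (l2_nonneg _))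

lemma phiTilde_sq_mul_le {t d : ℕ} (X : Design t d) {s : ℝ} {v : Vec d} (hv : (l0 v : ℝ) ≤ s) :
    phiTilde X s ^ 2 * (t * l2 v ^ 2) ≤ l2 (app X v) ^ 2 := by
  by_cases h0 : v = 0
  · have : l2 v ^ 2 = 0 := by simp [l2_sq, h0]
    rw [this]; simp; positivity
  have h : phiTilde X s ≤ l2 (app X v) / (Real.sqrt (t : ℝ) * l2 v) :=
    ciInf_le (f := fun δ : {δ : Vec d // δ ≠ 0 ∧ (l0 δ : ℝ) ≤ s} =>
      l2 (app X δ.1) / (Real.sqrt (t : ℝ) * l2 δ.1))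
      ⟨0, by
        rintro _ ⟨δ, rfl⟩
        exact div_nonneg (l2_nonneg _) (mul_nonneg (Real.sqrt_nonneg _) (l2_nonneg _))⟩
      ⟨v, h0, hv⟩
  have h2 := mul_le_of_le_div₀ (l2_nonneg _) (mul_nonneg (Real.sqrt_nonneg _) (l2_nonneg _)) h
  have h3 := pow_le_pow_left₀ (mul_nonneg (phiTilde_nonneg X s)
    (mul_nonneg (Real.sqrt_nonneg _) (l2_nonneg _))) h2 2
  simpa only [mul_pow, Real.sq_sqrt (Nat.cast_nonneg (α := ℝ) _)] using h3

/-- Sparse vectors satisfy an `ℓ₁` compatibility inequality with no cone condition. -/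
lemma phiTilde_sq_mul_l1_le {t d : ℕ} (X : Design t d) {s m : ℝ} (hms : m ≤ s) {v : Vec d}
    (hv : (l0 v : ℝ) ≤ m) :
    phiTilde X s ^ 2 * (t * l1 v ^ 2) ≤ m * l2 (app X v) ^ 2 := by
  have h1 : l1 v ^ 2 ≤ m * l2 v ^ 2 :=
    (l1_sq_le v).trans (mul_le_mul_of_nonneg_right hv (sq_nonneg _))
  have hm : 0 ≤ m := (Nat.cast_nonneg _).trans hv
  calc phiTilde X s ^ 2 * (t * l1 v ^ 2) ≤ phiTilde X s ^ 2 * (t * (m * l2 v ^ 2)) := by gcongr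
    _ = m * (phiTilde X s ^ 2 * (t * l2 v ^ 2)) := by ring
    _ ≤ _ := mul_le_mul_of_nonneg_left (phiTilde_sq_mul_le X (hv.trans hms)) hm

lemma l0_sub_le {d : ℕ} (u v : Vec d) : l0 (fun j => u j - v j) ≤ l0 u + l0 v := by
  refine (Finset.card_le_card (t := supp u ∪ supp v) fun j hj => ?_).trans
    (Finset.card_union_le _ _)
  have hj' : u j - v j ≠ 0 := (Finset.mem_filter.1 hj).2
  by_contra h
  have h' : u j = 0 ∧ v j = 0 := by simpa [supp] using h
  exact hj' (by rw [h'.1, h'.2, sub_zero])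

lemma l0_le {d : ℕ} (v : Vec d) : l0 v ≤ d := by
  have h := Finset.card_le_univ (supp v)
  rwa [Fintype.card_fin] at h

lemma l2_app_sq_le {t d : ℕ} {X : Design t d} {b : ℝ} (hX : ∀ i j, |X i j| ≤ b) (v : Vec d) :
    l2 (app X v) ^ 2 ≤ t * (b * l1 v) ^ 2 := by
  rw [l2_sq]
  have h : ∀ i, app X v i ^ 2 ≤ (b * l1 v) ^ 2 := fun i => by
    rw [← sq_abs]
    refine pow_le_pow_left₀ (abs_nonneg _) ?_ 2
    calc |app X v i| ≤ ∑ j, |X i j * v j| := by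
          rw [app, dot]; exact Finset.abs_sum_le_sum_abs _ _
      _ ≤ ∑ j, b * |v j| := Finset.sum_le_sum fun j _ => by
          rw [abs_mul]; exact mul_le_mul_of_nonneg_right (hX i j) (abs_nonneg _)
      _ = b * l1 v := by rw [l1, Finset.mul_sum]
  calc _ ≤ ∑ _i : Fin t, (b * l1 v) ^ 2 := Finset.sum_le_sum fun i _ => h i
    _ = _ := by simp

/-- Testing `phiTilde` on a coordinate vector. -/
lemma phiTilde_sq_le {t d : ℕ} {X : Design t d} {b : ℝ} (hX : ∀ i j, |X i j| ≤ b) (ht : 1 ≤ t)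
    (j : Fin d) {s : ℝ} (hs : 1 ≤ s) : phiTilde X s ^ 2 ≤ b ^ 2 := by
  have h0 : l0 (Pi.single j (1 : ℝ)) = 1 := by
    have : supp (Pi.single j (1 : ℝ)) = {j} := by
      ext k; by_cases h : k = j <;> simp [supp, h]
    rw [l0, this, Finset.card_singleton]
  have h1 : l1 (Pi.single j (1 : ℝ)) = 1 := by
    rw [l1, Finset.sum_eq_single j] <;> simp +contextual
  have h2 : l2 (Pi.single j (1 : ℝ)) ^ 2 = 1 := by
    rw [l2_sq, Finset.sum_eq_single j] <;> simp +contextual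
  have h3 := phiTilde_sq_mul_le X (s := s) (v := Pi.single j (1 : ℝ)) (by rw [h0]; simpa using hs)
  have h4 := h3.trans (l2_app_sq_le hX _)
  rw [h1, h2, mul_one, mul_one, mul_comm] at h4
  exact le_of_mul_le_mul_left h4 (by exact_mod_cast ht)

lemma abs_dot_app_le {t d : ℕ} (X : Design t d) (e : Vec t) (v : Vec d) {m : ℝ}
    (hm : ∀ j, |∑ i, e i * X i j| ≤ m) : |dot e (app X v)| ≤ m * l1 v := by
  have h : dot e (app X v) = ∑ j, (∑ i, e i * X i j) * v j := by
    simp only [dot, app, Finset.mul_sum, Finset.sum_mul]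
    rw [Finset.sum_comm]
    exact Finset.sum_congr rfl fun _ _ => Finset.sum_congr rfl fun _ _ => by ring
  rw [h, l1, Finset.mul_sum]
  refine (Finset.abs_sum_le_sum_abs _ _).trans (Finset.sum_le_sum fun j _ => ?_)
  rw [abs_mul]
  exact mul_le_mul_of_nonneg_right (hm j) (abs_nonneg _)

lemma NoiseControlled.abs_dot_app_le {t d : ℕ} {σ xmax : ℝ} {e : Vec t} {X : Design t d}
    (h : NoiseControlled σ xmax e X) (ht : 1 ≤ t) (v : Vec d) :
    |dot e (app X v)| ≤ σ * lamBar xmax t d * l1 v := by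
  refine SparseBandit.abs_dot_app_le X e v fun j => ?_
  have ht0 : (0 : ℝ) < t := by exact_mod_cast ht
  have h1 := (div_le_iff₀ ht0).1 (h j)
  refine h1.trans (le_of_eq ?_)
  have hlog : 0 ≤ Real.log t := Real.log_nonneg (by exact_mod_cast ht)
  have h2 : 2 * (t : ℝ) * (Real.log d + Real.log t) =
      (Real.sqrt (2 * Real.log t) ^ 2 + 2 * Real.log d) / t * t ^ 2 := by
    rw [Real.sq_sqrt (by positivity)]
    field_simp
    ring
  rw [lamBar, h2, Real.sqrt_mul' _ (sq_nonneg _), Real.sqrt_sq ht0.le]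
  ring

/-- The triangle inequality behind the cone condition, split at the support of `βs`. -/
lemma l1_sub_l1_le {d : ℕ} (βs β : Vec d) :
    l1 βs - l1 β ≤ ∑ j ∈ supp βs, |β j - βs j| - ∑ j ∈ (supp βs)ᶜ, |β j - βs j| := by
  have h : ∀ v : Vec d, l1 v = ∑ j ∈ supp βs, |v j| + ∑ j ∈ (supp βs)ᶜ, |v j| := fun v =>
    (Finset.sum_add_sum_compl _ _).symm
  rw [h β, l1_eq_sum_supp βs]
  have h1 : ∑ j ∈ supp βs, |βs j| ≤ ∑ j ∈ supp βs, |β j| + ∑ j ∈ supp βs, |β j - βs j| := by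
    rw [← Finset.sum_add_distrib]
    refine Finset.sum_le_sum fun j _ => ?_
    have := abs_sub_abs_le_abs_sub (βs j) (β j)
    rw [abs_sub_comm] at this
    linarith
  have h2 : ∑ j ∈ (supp βs)ᶜ, |β j - βs j| = ∑ j ∈ (supp βs)ᶜ, |β j| := by
    refine Finset.sum_congr rfl fun j hj => ?_
    have : βs j = 0 := by simpa [supp] using hj
    rw [this, sub_zero]
  linarith

/-! ### The Gaussian likelihood ratio -/

/-- The logarithm of the likelihood ratio of the parameter `βs + v` against `βs`, where `e` is the
residual vector of `βs`. -/
noncomputable def logRatio {t d : ℕ} (σ : ℝ) (X : Design t d) (e : Vec t) (v : Vec d) : ℝ :=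
  (2 * dot e (app X v) - l2 (app X v) ^ 2) / (2 * σ ^ 2)

lemma likelihood_eq_mul {t d : ℕ} {σ : ℝ} (hσ : 0 < σ) (X : Design t d) (r : Vec t)
    (βs β : Vec d) :
    likelihood σ X r β = likelihood σ X r βs *
      ENNReal.ofReal (Real.exp
        (logRatio σ X (fun i => r i - app X βs i) (fun j => β j - βs j))) := by
  have h : logRatio σ X (fun i => r i - app X βs i) (fun j => β j - βs j) =
      ∑ i, (2 * ((r i - app X βs i) * (app X β i - app X βs i)) -
        (app X β i - app X βs i) ^ 2) / (2 * σ ^ 2) := by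
    simp only [logRatio, l2_sq, dot, app_sub]
    rw [← Finset.sum_div, Finset.sum_sub_distrib, ← Finset.mul_sum]
  rw [h, Real.exp_sum, ENNReal.ofReal_prod_of_nonneg fun _ _ => (Real.exp_pos _).le]
  simp only [likelihood]
  rw [← Finset.prod_mul_distrib]
  refine Finset.prod_congr rfl fun i _ => ?_
  rw [gaussianPDF, gaussianPDF, ← ENNReal.ofReal_mul (gaussianPDFReal_nonneg _ _ _),
    gaussianPDFReal, gaussianPDFReal, mul_assoc _ (Real.exp _) (Real.exp _), ← Real.exp_add,
    Real.coe_toNNReal _ (sq_nonneg σ)]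
  congr 3
  field_simp
  ring

lemma measurable_app {t d : ℕ} (X : Design t d) (i : Fin t) : Measurable fun β => app X β i := by
  unfold app dot
  fun_prop

lemma measurable_likelihood {t d : ℕ} (σ : ℝ) (X : Design t d) (r : Vec t) :
    Measurable (likelihood σ X r) := by
  unfold likelihood
  refine Finset.measurable_prod _ fun i _ => ?_
  have := measurable_app X i
  unfold gaussianPDF gaussianPDFReal
  fun_prop

/-- Outside the cone the Laplace penalty beats the noise; inside it the quadratic term does, by
compatibility. -/
lemma logRatio_add_le_of_phiComp {t d : ℕ} {σ b L : ℝ} (hσ : 0 < σ) (hb : 0 ≤ b) {X : Design t d}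
    {e : Vec t} {βs β : Vec d} (ht : 1 ≤ t) (hφ : 0 < phiComp (supp βs) X)
    (hL : 5 / 3 * L ≤ σ ^ 2 * b)
    (hnoise : |dot e (app X fun j => β j - βs j)| ≤ L * l1 fun j => β j - βs j) :
    logRatio σ X e (fun j => β j - βs j) + b * l1 βs ≤
      3 / 2 * (σ ^ 2 * b ^ 2 * (supp βs).card / (t * phiComp (supp βs) X ^ 2)) +
        (b * l1 β - b / 10 * l1 fun j => β j - βs j) := by
  set v : Vec d := fun j => β j - βs j with hv
  set p := ∑ j ∈ supp βs, |v j| with hp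
  set q := ∑ j ∈ (supp βs)ᶜ, |v j| with hq
  have hp0 : 0 ≤ p := Finset.sum_nonneg fun _ _ => abs_nonneg _
  have hq0 : 0 ≤ q := Finset.sum_nonneg fun _ _ => abs_nonneg _
  have hl1 : l1 v = p + q := (Finset.sum_add_sum_compl _ _).symm
  have htri : l1 βs - l1 β ≤ p - q := l1_sub_l1_le βs β
  have ht0 : (0 : ℝ) < t := by exact_mod_cast ht
  have hσ2 : 0 < σ ^ 2 := by positivity
  set N := l2 (app X v) ^ 2 with hN
  have hN0 : 0 ≤ N := sq_nonneg _
  set F := σ ^ 2 * b ^ 2 * (supp βs).card / (t * phiComp (supp βs) X ^ 2) with hF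
  have hF0 : 0 ≤ F := by positivity
  have hratio : logRatio σ X e v ≤ 3 / 5 * (b * (p + q)) - N / (2 * σ ^ 2) := by
    have h1 : dot e (app X v) ≤ 3 / 5 * (σ ^ 2 * b) * (p + q) := by
      rw [hl1] at hnoise
      have h2 : L * (p + q) ≤ 3 / 5 * (σ ^ 2 * b) * (p + q) :=
        mul_le_mul_of_nonneg_right (by linarith) (by positivity)
      exact (le_abs_self _).trans (hnoise.trans h2)
    rw [logRatio, div_le_iff₀ (by positivity), sub_mul, div_mul_cancel₀ _ (by positivity)]
    linarith
  have hpen : b * l1 βs - b * l1 β ≤ b * p - b * q := by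
    have := mul_le_mul_of_nonneg_left htri hb
    linarith
  -- It remains to absorb the total `ℓ₁` weight `b * (17 / 10 * p - 3 / 10 * q)`.
  suffices h : 17 / 10 * (b * p) - 3 / 10 * (b * q) ≤ 3 / 2 * F + N / (2 * σ ^ 2) by
    rw [hl1]
    linarith
  by_cases hc : v ∈ cone 7 (supp βs)
  · have hcomp := phiComp_sq_mul_le X hc
    rw [hl1] at hcomp
    have hG : b ^ 2 * (p + q) ^ 2 ≤ F * (N / σ ^ 2) := by
      have : F * (N / σ ^ 2) =
          b ^ 2 * (N * (supp βs).card) / (t * phiComp (supp βs) X ^ 2) := by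
        rw [hF]; field_simp
      rw [this, le_div_iff₀ (by positivity)]
      have h3 := mul_le_mul_of_nonneg_left hcomp (sq_nonneg b)
      linarith
    have hM0 : 0 ≤ N / σ ^ 2 := by positivity
    have h4 : N / (2 * σ ^ 2) = N / σ ^ 2 / 2 := by field_simp
    rw [h4]
    have h5 : 17 / 10 * (b * (p + q)) ≤ 3 / 2 * F + N / σ ^ 2 / 2 := by
      refine le_of_sq_le_sq ?_ (by positivity)
      have h6 : (17 / 10 * (b * (p + q))) ^ 2 = 289 / 100 * (b ^ 2 * (p + q) ^ 2) := by ring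
      have h7 : (3 / 2 * F + N / σ ^ 2 / 2) ^ 2 =
          (3 / 2 * F - N / σ ^ 2 / 2) ^ 2 + 3 * (F * (N / σ ^ 2)) := by ring
      have h8 := mul_nonneg hF0 hM0
      have h9 := sq_nonneg (3 / 2 * F - N / σ ^ 2 / 2)
      linarith
    have h6 := mul_nonneg hb hq0
    linarith
  · have h7 : 7 * p ≤ q := by
      by_contra hcon
      refine hc ⟨(not_le.1 hcon).le, ?_⟩
      by_contra hz
      push Not at hz
      have : p = 0 := Finset.sum_eq_zero fun j hj => by rw [hz j hj, abs_zero]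
      rw [this] at hcon
      linarith
    have h8 := mul_le_mul_of_nonneg_left h7 hb
    have h9 : 0 ≤ N / (2 * σ ^ 2) := by positivity
    have h10 := mul_nonneg hb hp0
    linarith

/-- For sparse differences of `ℓ₁` norm at least of order `σ² b κ m / t`, the quadratic term beats
both the noise and the Laplace penalty, with any prescribed factor `g / 16` in front. -/
lemma logRatio_add_le_of_sparse {t d : ℕ} {σ b L κ m g : ℝ} (hσ : 0 < σ) (hb : 0 ≤ b)
    {X : Design t d} {e : Vec t} {βs β : Vec d} (hκ : 0 < κ) (hm : 0 < m)
    (hL : 5 / 3 * L ≤ σ ^ 2 * b)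
    (hnoise : |dot e (app X fun j => β j - βs j)| ≤ L * l1 fun j => β j - βs j)
    (hX : t * (l1 fun j => β j - βs j) ^ 2 ≤
      8 * κ * m * l2 (app X fun j => β j - βs j) ^ 2)
    (hR : g * (σ ^ 2 * b * κ * m) ≤ t * l1 fun j => β j - βs j) :
    logRatio σ X e (fun j => β j - βs j) + b * l1 βs ≤
      -((g / 16 - 17 / 10) * (b * l1 fun j => β j - βs j)) +
        (b * l1 β - b / 10 * l1 fun j => β j - βs j) := by
  set v : Vec d := fun j => β j - βs j with hv
  have hl0 : 0 ≤ l1 v := l1_nonneg v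
  set N := l2 (app X v) ^ 2 with hN
  have h1 : dot e (app X v) ≤ 3 / 5 * (σ ^ 2 * b) * l1 v :=
    (le_abs_self _).trans (hnoise.trans (mul_le_mul_of_nonneg_right (by linarith) hl0))
  have h2 : g * (σ ^ 2 * b) * l1 v ≤ 8 * N := by
    have h3 := mul_le_mul_of_nonneg_right hR hl0
    have h4 : 0 < κ * m := by positivity
    refine le_of_mul_le_mul_left ?_ h4
    linarith
  have hratio : logRatio σ X e v ≤ 3 / 5 * (b * l1 v) - g / 16 * (b * l1 v) := by
    rw [logRatio, div_le_iff₀ (by positivity)]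
    linarith
  have htri : b * l1 βs ≤ b * l1 β + b * l1 v := by
    rw [← mul_add]
    refine mul_le_mul_of_nonneg_left ?_ hb
    have h5 := l1_sub_l1_le βs β
    have h6 : l1 v = ∑ j ∈ supp βs, |v j| + ∑ j ∈ (supp βs)ᶜ, |v j| :=
      (Finset.sum_add_sum_compl _ _).symm
    have h7 : 0 ≤ ∑ j ∈ (supp βs)ᶜ, |v j| := Finset.sum_nonneg fun _ _ => abs_nonneg _
    linarith
  linarith

/-- Close to `βs` the likelihood ratio is bounded below. -/
lemma neg_le_logRatio {t d : ℕ} {σ b L xmax : ℝ} (hσ : 0 < σ) (hb : 0 < b)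
    {X : Design t d} {e : Vec t} {v : Vec d} (hX : ∀ i j, |X i j| ≤ xmax)
    (hL : L ≤ σ ^ 2 * b) (hb' : t * xmax ^ 2 ≤ σ ^ 2 * b ^ 2)
    (hnoise : |dot e (app X v)| ≤ L * l1 v) (hv : b * l1 v ≤ 1) :
    -(3 / 2) ≤ logRatio σ X e v := by
  have hl0 := l1_nonneg v
  have h1 : -(σ ^ 2) ≤ dot e (app X v) := by
    have h2 : L * l1 v ≤ σ ^ 2 * (b * l1 v) := by
      rw [← mul_assoc]; exact mul_le_mul_of_nonneg_right hL hl0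
    have h3 : σ ^ 2 * (b * l1 v) ≤ σ ^ 2 * 1 := mul_le_mul_of_nonneg_left hv (sq_nonneg _)
    have h4 := neg_abs_le (dot e (app X v))
    linarith
  have h5 : l2 (app X v) ^ 2 ≤ σ ^ 2 := by
    have h6 : t * (xmax * l1 v) ^ 2 ≤ σ ^ 2 * (b * l1 v) ^ 2 := by
      have := mul_le_mul_of_nonneg_right hb' (sq_nonneg (l1 v))
      linarith
    have h7 : (b * l1 v) ^ 2 ≤ 1 := pow_le_one₀ (by positivity) hv
    have h8 := mul_le_mul_of_nonneg_left h7 (sq_nonneg σ)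
    linarith [l2_app_sq_le hX v]
  rw [logRatio, le_div_iff₀ (by positivity)]
  linarith

/-! ### Laplace integrals -/

lemma lintegral_exp_neg_mul_abs {k : ℝ} (hk : 0 < k) :
    ∫⁻ x : ℝ, ENNReal.ofReal (Real.exp (-k * |x|)) = ENNReal.ofReal (2 / k) := by
  have hval : ∫ x : ℝ, Real.exp (-k * |x|) = 2 / k := by
    rw [integral_comp_abs (f := fun x => Real.exp (-k * x)),
      integral_exp_mul_Ioi (neg_lt_zero.2 hk)]
    simp; field_simp
  have hint : Integrable fun x : ℝ => Real.exp (-k * |x|) := by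
    by_contra h
    rw [integral_undef h] at hval
    exact absurd hval (by positivity)
  rw [← hval, ofReal_integral_eq_lintegral_ofReal hint
    (Filter.Eventually.of_forall fun _ => (Real.exp_pos _).le)]

instance (b : ℝ) : SigmaFinite (laplace b) := by
  unfold laplace
  infer_instance

lemma lintegral_laplace {b : ℝ} (f : ℝ → ℝ≥0∞) (hf : Measurable f) :
    ∫⁻ x, f x ∂laplace b = ∫⁻ x, ENNReal.ofReal (b / 2 * Real.exp (-b * |x|)) * f x := by
  rw [laplace, lintegral_withDensity_eq_lintegral_mul _ (by fun_prop) hf]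
  rfl

/-- Removing the Laplace density and replacing it by a slower exponential centred at `c` costs a
factor `10`. -/
lemma lintegral_laplace_exp {b : ℝ} (hb : 0 < b) (c : ℝ) :
    ∫⁻ x, ENNReal.ofReal (Real.exp (b * |x| - b / 10 * |x - c|)) ∂laplace b = 10 := by
  rw [lintegral_laplace _ (by fun_prop)]
  have h : ∀ x : ℝ, ENNReal.ofReal (b / 2 * Real.exp (-b * |x|)) *
      ENNReal.ofReal (Real.exp (b * |x| - b / 10 * |x - c|)) =
      ENNReal.ofReal (b / 2) * ENNReal.ofReal (Real.exp (-(b / 10) * |x - c|)) := fun x => by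
    rw [← ENNReal.ofReal_mul (by positivity), ← ENNReal.ofReal_mul (by positivity), mul_assoc,
      ← Real.exp_add]
    congr 3
    ring
  simp only [h]
  rw [lintegral_const_mul _ (by fun_prop),
    lintegral_sub_right_eq_self (fun x => ENNReal.ofReal (Real.exp (-(b / 10) * |x|))) c,
    lintegral_exp_neg_mul_abs (by positivity), ← ENNReal.ofReal_mul (by positivity)]
  rw [show b / 2 * (2 / (b / 10)) = 10 by field_simp]
  simp

lemma lintegral_slab_exp_le {d : ℕ} {b : ℝ} (hb : 0 < b) (S : Finset (Fin d)) (c : Vec d) :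
    ∫⁻ β, ENNReal.ofReal (Real.exp (b * l1 β - b / 10 * l1 fun j => β j - c j)) ∂slab b S
      ≤ 10 ^ S.card := by
  have hsf : ∀ j, SigmaFinite (if j ∈ S then laplace b else Measure.dirac 0) := fun j => by
    split_ifs <;> infer_instance
  set f : Fin d → ℝ → ℝ := fun j x => Real.exp (b * |x| - b / 10 * |x - c j|) with hf
  have hmeas : ∀ j, Measurable (f j) := fun j => by rw [hf]; fun_prop
  have hpos : ∀ j x, 0 ≤ f j x := fun j x => (Real.exp_pos _).le
  have hle : ∀ j, ∫⁻ x, ENNReal.ofReal (f j x) ∂(if j ∈ S then laplace b else Measure.dirac 0) ≤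
      if j ∈ S then 10 else 1 := fun j => by
    split_ifs with h
    · exact (lintegral_laplace_exp hb (c j)).le
    · rw [lintegral_dirac]
      refine ENNReal.ofReal_le_one.2 (Real.exp_le_one_iff.2 ?_)
      simp only [abs_zero, mul_zero, zero_sub, neg_nonpos]
      positivity
  have hint : ∀ j, Integrable (f j) (if j ∈ S then laplace b else Measure.dirac 0) := fun j => by
    refine ⟨(hmeas j).aestronglyMeasurable, ?_⟩
    rw [hasFiniteIntegral_iff_ofReal (Filter.Eventually.of_forall (hpos j))]
    refine (hle j).trans_lt ?_
    split_ifs <;> simp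
  have hprod : ∀ β : Vec d, Real.exp (b * l1 β - b / 10 * l1 fun j => β j - c j) =
      ∏ j, f j (β j) := fun β => by
    rw [hf, ← Real.exp_sum, Finset.sum_sub_distrib, ← Finset.mul_sum, ← Finset.mul_sum]
    rfl
  simp only [hprod, slab]
  rw [← ofReal_integral_eq_lintegral_ofReal (Integrable.fintype_prod hint)
      (Filter.Eventually.of_forall fun β => Finset.prod_nonneg fun j _ => hpos j _),
    integral_fintype_prod_eq_prod, ENNReal.ofReal_prod_of_nonneg
      fun j _ => integral_nonneg (hpos j)]
  calc _ ≤ ∏ j, (if j ∈ S then (10 : ℝ≥0∞) else 1) := by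
        refine Finset.prod_le_prod' fun j _ => ?_
        rw [ofReal_integral_eq_lintegral_ofReal (hint j)
          (Filter.Eventually.of_forall (hpos j))]
        exact hle j
    _ = 10 ^ S.card := by
        rw [Finset.prod_ite_mem, Finset.univ_inter, Finset.prod_const]

/-- Vectors drawn from `slab b S` vanish off `S`. -/
lemma ae_slab_supp_subset {d : ℕ} (b : ℝ) (S : Finset (Fin d)) :
    ∀ᵐ β ∂slab b S, supp β ⊆ S := by
  have hsf : ∀ j, SigmaFinite (if j ∈ S then laplace b else Measure.dirac 0) := fun j => by
    split_ifs <;> infer_instance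
  have h : ∀ j, ∀ᵐ β ∂slab b S, j ∉ S → β j = 0 := fun j => by
    by_cases hj : j ∈ S
    · exact Filter.Eventually.of_forall fun _ h => absurd hj h
    · have h0 : ∀ᵐ x ∂(if j ∈ S then laplace b else Measure.dirac 0), x = 0 := by
        rw [if_neg hj, ae_dirac_eq]; exact rfl
      filter_upwards [Measure.tendsto_eval_ae_ae (i := j) h0] with β hβ _ using hβ
  filter_upwards [ae_all_iff.2 h] with β hβ j hj
  by_contra hjS
  exact (Finset.mem_filter.1 hj).2 (hβ j hjS)

/-- The mass of a small interval around `c`, bounded by its length times the smallest density. -/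
lemma laplace_Icc_ge {b η : ℝ} (hb : 0 < b) (c : ℝ) :
    ENNReal.ofReal (b * η * Real.exp (-b * |c| - b * η)) ≤ laplace b (Set.Icc (c - η) (c + η)) := by
  rw [laplace, withDensity_apply _ measurableSet_Icc]
  calc ENNReal.ofReal (b * η * Real.exp (-b * |c| - b * η))
      = ∫⁻ _ in Set.Icc (c - η) (c + η),
          ENNReal.ofReal (b / 2 * Real.exp (-b * |c| - b * η)) := by
        rw [setLIntegral_const, Real.volume_Icc, ← ENNReal.ofReal_mul (by positivity)]
        congr 1
        ring
    _ ≤ _ := by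
        refine setLIntegral_mono' measurableSet_Icc fun x hx => ?_
        refine ENNReal.ofReal_le_ofReal (mul_le_mul_of_nonneg_left ?_ (by positivity))
        refine Real.exp_le_exp.2 ?_
        have h1 : |x - c| ≤ η := abs_le.2 ⟨by linarith [hx.1], by linarith [hx.2]⟩
        have h2 : |x| ≤ |c| + η := by
          have := abs_sub_abs_le_abs_sub x c
          linarith
        have := mul_le_mul_of_nonneg_left h2 hb.le
        linarith

/-- A lower bound on the prior mass of an `ℓ₁` ball of radius `1 / b` around `βs`, given the true
support. -/
lemma slab_ball_ge {d : ℕ} {b : ℝ} (hb : 0 < b) (βs : Vec d) (hs : 1 ≤ l0 βs) :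
    ENNReal.ofReal ((l0 βs : ℝ)⁻¹ ^ l0 βs * Real.exp (-b * l1 βs - 1)) ≤
      slab b (supp βs) {β | b * (l1 fun j => β j - βs j) ≤ 1} := by
  have hsf : ∀ j, SigmaFinite (if j ∈ supp βs then laplace b else Measure.dirac 0) := fun j => by
    split_ifs <;> infer_instance
  have hs0 : (0 : ℝ) < l0 βs := by exact_mod_cast hs
  set η : ℝ := (b * l0 βs)⁻¹ with hη
  have hη0 : 0 ≤ η := by positivity
  have hbη : b * η = (l0 βs : ℝ)⁻¹ := by rw [hη]; field_simp
  set s : Fin d → Set ℝ := fun j =>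
    if j ∈ supp βs then Set.Icc (βs j - η) (βs j + η) else {0} with hsdef
  have hsub : Set.pi Set.univ s ⊆ {β | b * (l1 fun j => β j - βs j) ≤ 1} := by
    intro β hβ
    have hoff : ∀ j ∉ supp βs, β j = 0 := fun j hj => by
      have := hβ j (Set.mem_univ _)
      rw [hsdef] at this
      simpa only [hj, if_false, Set.mem_singleton_iff] using this
    have hon : ∀ j ∈ supp βs, |β j - βs j| ≤ η := fun j hj => by
      have := hβ j (Set.mem_univ _)
      rw [hsdef] at this
      simp only [hj, if_true] at this
      exact abs_le.2 ⟨by linarith [this.1], by linarith [this.2]⟩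
    have h1 : (l1 fun j => β j - βs j) ≤ l0 βs * η := by
      rw [l1, ← Finset.sum_add_sum_compl (supp βs), Finset.sum_eq_zero (s := (supp βs)ᶜ), add_zero,
        l0, ← nsmul_eq_mul]
      · exact Finset.sum_le_card_nsmul _ _ _ hon
      · intro j hj
        have hj' := Finset.mem_compl.1 hj
        have hβj : βs j = 0 := by simpa [supp] using hj'
        rw [hoff j hj', hβj, sub_zero, abs_zero]
    calc b * (l1 fun j => β j - βs j) ≤ b * (l0 βs * η) := mul_le_mul_of_nonneg_left h1 hb.le
      _ = 1 := by rw [hη]; field_simp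
  refine le_trans ?_ (measure_mono hsub)
  rw [slab, Measure.pi_pi]
  have hfac : ∀ j, ENNReal.ofReal
      (if j ∈ supp βs then b * η * Real.exp (-b * |βs j| - b * η) else 1) ≤
      (if j ∈ supp βs then laplace b else Measure.dirac 0) (s j) := fun j => by
    rw [hsdef]
    split_ifs with h
    · simp only [h, if_true]
      exact laplace_Icc_ge hb _
    · simp [h]
  refine le_trans (le_of_eq ?_) (Finset.prod_le_prod' fun j _ => hfac j)
  rw [← ENNReal.ofReal_prod_of_nonneg fun j _ => by split_ifs <;> positivity]
  congr 1
  rw [Finset.prod_ite_mem, Finset.univ_inter, Finset.prod_mul_distrib, Finset.prod_const, hbη,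
    ← Real.exp_sum, Finset.sum_sub_distrib, ← Finset.mul_sum, ← l1_eq_sum_supp, Finset.sum_const,
    nsmul_eq_mul]
  change _ = _ * Real.exp (_ - (l0 βs : ℝ) * _)
  rw [mul_inv_cancel₀ hs0.ne']
  rfl

/-! ### Weights of the sparsity prior -/

namespace IsSparsityPrior

variable {d : ℕ} {A₁ A₂ A₃ A₄ : ℝ} {w : ℕ → ℝ}

lemma le_pow_mul (hw : IsSparsityPrior d A₁ A₂ A₃ A₄ w) (hA₂ : 0 ≤ A₂) (k n : ℕ)
    (hn : k + n ≤ d) : w (k + n) ≤ (A₂ * (d : ℝ) ^ (-A₄)) ^ n * w k := by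
  induction n with
  | zero => simp
  | succ n ih =>
    have h1 := hw.upper (k + n + 1) (by omega) (by omega)
    have h2 := mul_le_mul_of_nonneg_left (ih (by omega))
      (show 0 ≤ A₂ * (d : ℝ) ^ (-A₄) by positivity)
    rw [pow_succ', mul_assoc]
    exact h1.trans h2

lemma pow_mul_le (hw : IsSparsityPrior d A₁ A₂ A₃ A₄ w) (hA₁ : 0 ≤ A₁) (k n : ℕ)
    (hn : k + n ≤ d) : (A₁ * (d : ℝ) ^ (-A₃)) ^ n * w k ≤ w (k + n) := by
  induction n with
  | zero => simp
  | succ n ih =>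
    have h1 := hw.lower (k + n + 1) (by omega) (by omega)
    have h2 := mul_le_mul_of_nonneg_left (ih (by omega))
      (show 0 ≤ A₁ * (d : ℝ) ^ (-A₃) by positivity)
    rw [pow_succ', mul_assoc]
    exact h2.trans h1

/-- For large `d` the weights decay fast enough to pay for a factor `10` per coordinate. -/
lemma mul_ten_pow_le (hw : IsSparsityPrior d A₁ A₂ A₃ A₄ w) (hA₂ : 0 ≤ A₂) (hd : 1 ≤ d)
    (hd2 : 10 * A₂ ≤ (d : ℝ) ^ (A₄ / 2)) (k n : ℕ) (hn : k + n ≤ d) :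
    w (k + n) * 10 ^ n ≤ Real.exp (-(A₄ / 2 * n * Real.log d)) * w k := by
  have hd0 : (0 : ℝ) < d := by exact_mod_cast hd
  have hwk := hw.nonneg k (by omega)
  have h1 : A₂ * (d : ℝ) ^ (-A₄) * 10 ≤ Real.exp (-(A₄ / 2 * Real.log d)) := by
    calc A₂ * (d : ℝ) ^ (-A₄) * 10 = 10 * A₂ * (d : ℝ) ^ (-A₄) := by ring
      _ ≤ (d : ℝ) ^ (A₄ / 2) * (d : ℝ) ^ (-A₄) :=
          mul_le_mul_of_nonneg_right hd2 (Real.rpow_nonneg hd0.le _)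
      _ = _ := by
          rw [← Real.rpow_add hd0, Real.rpow_def_of_pos hd0]
          congr 1
          ring
  calc w (k + n) * 10 ^ n ≤ (A₂ * (d : ℝ) ^ (-A₄)) ^ n * w k * 10 ^ n :=
        mul_le_mul_of_nonneg_right (hw.le_pow_mul hA₂ k n hn) (by positivity)
    _ = (A₂ * (d : ℝ) ^ (-A₄) * 10) ^ n * w k := by rw [mul_pow]; ring
    _ ≤ Real.exp (-(A₄ / 2 * Real.log d)) ^ n * w k := by gcongr
    _ = _ := by
        rw [← Real.exp_nat_mul]
        congr 2
        ring

/-- No weight exceeds the weight of size `s` by more than a factor `d ^ ((A₃ + 1) s)`. -/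
lemma le_exp_mul (hw : IsSparsityPrior d A₁ A₂ A₃ A₄ w) (hA₂ : 0 ≤ A₂) (hA₃ : 0 ≤ A₃)
    (hA₄ : 0 ≤ A₄) (hd : 1 ≤ d) (hd1 : (d : ℝ)⁻¹ ≤ A₁) (hd2 : 10 * A₂ ≤ (d : ℝ) ^ (A₄ / 2))
    {s k : ℕ} (hs : s ≤ d) (hk : k ≤ d) :
    w k ≤ Real.exp ((A₃ + 1) * s * Real.log d) * w s := by
  have hd0 : (0 : ℝ) < d := by exact_mod_cast hd
  have hlog : 0 ≤ Real.log d := Real.log_nonneg (by exact_mod_cast hd)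
  have hws := hw.nonneg s hs
  have hwk := hw.nonneg k hk
  have hA₁ : 0 < A₁ := lt_of_lt_of_le (by positivity) hd1
  rcases le_total s k with h | h
  · obtain ⟨n, rfl⟩ := Nat.exists_eq_add_of_le h
    have h1 := hw.mul_ten_pow_le hA₂ hd hd2 s n hk
    have h2 : w (s + n) ≤ w (s + n) * 10 ^ n :=
      le_mul_of_one_le_right hwk (one_le_pow₀ (by norm_num))
    refine (h2.trans h1).trans (mul_le_mul_of_nonneg_right (Real.exp_le_exp.2 ?_) hws)
    have h3 : 0 ≤ A₄ / 2 * n * Real.log d := by positivity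
    have h4 : 0 ≤ (A₃ + 1) * s * Real.log d := by positivity
    linarith
  · obtain ⟨n, rfl⟩ := Nat.exists_eq_add_of_le h
    have h1 := hw.pow_mul_le hA₁.le k n hs
    have h2 : Real.exp (-((A₃ + 1) * Real.log d)) ≤ A₁ * (d : ℝ) ^ (-A₃) := by
      calc Real.exp (-((A₃ + 1) * Real.log d)) = (d : ℝ)⁻¹ * (d : ℝ) ^ (-A₃) := by
            rw [← Real.rpow_neg_one, ← Real.rpow_add hd0, Real.rpow_def_of_pos hd0]
            congr 1
            ring
        _ ≤ _ := mul_le_mul_of_nonneg_right hd1 (Real.rpow_nonneg hd0.le _)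
    have h3 : Real.exp (-((A₃ + 1) * n * Real.log d)) * w k ≤ w (k + n) := by
      refine le_trans (mul_le_mul_of_nonneg_right ?_ hwk) h1
      calc Real.exp (-((A₃ + 1) * n * Real.log d)) = Real.exp (-((A₃ + 1) * Real.log d)) ^ n := by
            rw [← Real.exp_nat_mul]
            congr 1
            ring
        _ ≤ _ := by gcongr
    calc w k = Real.exp ((A₃ + 1) * n * Real.log d) *
          (Real.exp (-((A₃ + 1) * n * Real.log d)) * w k) := by
          rw [← mul_assoc, ← Real.exp_add, add_neg_cancel, Real.exp_zero, one_mul]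
      _ ≤ Real.exp ((A₃ + 1) * ((k + n : ℕ) : ℝ) * Real.log d) * w (k + n) := by
          refine mul_le_mul (Real.exp_le_exp.2 ?_) h3 (by positivity) (Real.exp_pos _).le
          push_cast
          gcongr
          exact le_add_of_nonneg_left (Nat.cast_nonneg _)

end IsSparsityPrior

/-! ### Posterior mass of a set -/

lemma lintegral_complexityPrior {d : ℕ} (w : ℕ → ℝ) (b : ℝ) (f : Vec d → ℝ≥0∞) :
    ∫⁻ β, f β ∂complexityPrior d w b =
      ∑ S : Finset (Fin d), ENNReal.ofReal (w S.card / (d.choose S.card : ℝ)) *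
        ∫⁻ β, f β ∂slab b S := by
  rw [complexityPrior, lintegral_finsetSum_measure]
  simp [lintegral_smul_measure]

lemma posterior_le_one {t d : ℕ} (prior : Measure (Vec d)) (σ : ℝ) (X : Design t d) (r : Vec t)
    (B : Set (Vec d)) : posterior prior σ X r B ≤ 1 := by
  refine (measure_mono (Set.subset_univ B)).trans ?_
  rw [posterior, Measure.smul_apply, withDensity_apply _ MeasurableSet.univ,
    Measure.restrict_univ, smul_eq_mul]
  exact ENNReal.inv_mul_le_one _

/-- The prior average of a function of the model size only. -/
lemma sum_weight_mul {d : ℕ} (w g : ℕ → ℝ) :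
    ∑ S : Finset (Fin d), w S.card / (d.choose S.card : ℝ) * g S.card =
      ∑ k ∈ Finset.range (d + 1), w k * g k := by
  have h := Finset.sum_powerset_apply_card (x := (Finset.univ : Finset (Fin d)))
    fun k => w k / (d.choose k : ℝ) * g k
  rw [Finset.powerset_univ, Finset.card_univ, Fintype.card_fin] at h
  rw [h]
  refine Finset.sum_congr rfl fun k hk => ?_
  have : (0 : ℝ) < d.choose k := by
    exact_mod_cast Nat.choose_pos (Nat.lt_succ_iff.1 (Finset.mem_range.1 hk))
  rw [nsmul_eq_mul]
  field_simp

/-- The posterior mass of `B` is at most `M` once the likelihood ratio on `B` is bounded, with an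
exponent `E k` on models of size `k`, and each size's share is at most `M / (d + 1)` times the
contribution of a small ball around `βs`. -/
lemma posterior_le {t d : ℕ} {σ b M : ℝ} (hσ : 0 < σ) (hb : 0 < b) {w E : ℕ → ℝ}
    (hw : ∀ k ≤ d, 0 ≤ w k) {X : Design t d} {r : Vec t} {βs : Vec d} (hs : 1 ≤ l0 βs)
    {B : Set (Vec d)} (hB : MeasurableSet B) (hM : 0 ≤ M)
    (hupper : ∀ k, ∀ β ∈ B, l0 β ≤ k →
      logRatio σ X (fun i => r i - app X βs i) (fun j => β j - βs j) + b * l1 βs ≤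
        E k + (b * l1 β - b / 10 * l1 fun j => β j - βs j))
    (hlower : ∀ v : Vec d, b * l1 v ≤ 1 →
      -(3 / 2) ≤ logRatio σ X (fun i => r i - app X βs i) v)
    (hsize : ∀ k ≤ d, w k * 10 ^ k * Real.exp (E k) * (d + 1) ≤
      M * (w (l0 βs) / (d.choose (l0 βs) : ℝ) * ((l0 βs : ℝ)⁻¹ ^ l0 βs * Real.exp (-(5 / 2))))) :
    posterior (complexityPrior d w b) σ X r B ≤ ENNReal.ofReal M := by
  set Z₀ := likelihood σ X r βs with hZ₀
  set a := ENNReal.ofReal (Real.exp (-b * l1 βs)) with ha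
  set W := w (l0 βs) / (d.choose (l0 βs) : ℝ) *
    ((l0 βs : ℝ)⁻¹ ^ l0 βs * Real.exp (-(5 / 2))) with hW
  have hcard : ∀ S : Finset (Fin d), S.card ≤ d := fun S => by
    simpa using Finset.card_le_univ S
  have hweight : ∀ S : Finset (Fin d), 0 ≤ w S.card / (d.choose S.card : ℝ) := fun S =>
    div_nonneg (hw _ (hcard S)) (Nat.cast_nonneg _)
  have hmeas : Measurable fun β : Vec d =>
      ENNReal.ofReal (Real.exp (b * l1 β - b / 10 * l1 fun j => β j - βs j)) := by
    unfold l1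
    fun_prop
  -- The numerator, one model at a time.
  have hmodel : ∀ S : Finset (Fin d), ∫⁻ β, B.indicator (likelihood σ X r) β ∂slab b S ≤
      Z₀ * (ENNReal.ofReal (Real.exp (E S.card)) * a) * 10 ^ S.card := fun S => by
    calc ∫⁻ β, B.indicator (likelihood σ X r) β ∂slab b S
        ≤ ∫⁻ β, Z₀ * (ENNReal.ofReal (Real.exp (E S.card)) * a) *
          ENNReal.ofReal (Real.exp (b * l1 β - b / 10 * l1 fun j => β j - βs j)) ∂slab b S := by
          refine lintegral_mono_ae ?_
          filter_upwards [ae_slab_supp_subset b S] with β hβ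
          by_cases hβB : β ∈ B
          · rw [Set.indicator_of_mem hβB, likelihood_eq_mul hσ X r βs β, mul_assoc]
            refine mul_le_mul_right ?_ _
            rw [ha, ← ENNReal.ofReal_mul (Real.exp_pos _).le,
              ← ENNReal.ofReal_mul (by positivity), ← Real.exp_add, ← Real.exp_add]
            refine ENNReal.ofReal_le_ofReal (Real.exp_le_exp.2 ?_)
            have := hupper S.card β hβB (Finset.card_le_card hβ)
            linarith
          · rw [Set.indicator_of_notMem hβB]
            exact zero_le
      _ ≤ _ := by
          rw [lintegral_const_mul _ hmeas]
          exact mul_le_mul_right (lintegral_slab_exp_le hb S βs) _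
  have hnum : ∫⁻ β in B, likelihood σ X r β ∂complexityPrior d w b ≤
      ENNReal.ofReal M * (Z₀ * a * ENNReal.ofReal W) := by
    rw [← lintegral_indicator hB, lintegral_complexityPrior]
    calc _ ≤ ∑ S : Finset (Fin d), Z₀ * a * ENNReal.ofReal
          (w S.card / (d.choose S.card : ℝ) * (10 ^ S.card * Real.exp (E S.card))) := by
          refine Finset.sum_le_sum fun S _ => ?_
          refine (mul_le_mul_right (hmodel S) _).trans (le_of_eq ?_)
          rw [ENNReal.ofReal_mul (hweight S), ENNReal.ofReal_mul (by positivity),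
            ENNReal.ofReal_pow (by norm_num), ENNReal.ofReal_ofNat]
          ring
      _ = Z₀ * a * ENNReal.ofReal
          (∑ k ∈ Finset.range (d + 1), w k * (10 ^ k * Real.exp (E k))) := by
          rw [← Finset.mul_sum, ← ENNReal.ofReal_sum_of_nonneg
            fun S _ => mul_nonneg (hweight S) (by positivity),
            sum_weight_mul w fun k => 10 ^ k * Real.exp (E k)]
      _ ≤ Z₀ * a * ENNReal.ofReal (M * W) := by
          refine mul_le_mul_right (ENNReal.ofReal_le_ofReal ?_) _
          have hd0 : (0 : ℝ) < d + 1 := by positivity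
          calc _ ≤ ∑ _k ∈ Finset.range (d + 1), M * W / ((d : ℝ) + 1) :=
                Finset.sum_le_sum fun k hk => by
                  rw [le_div_iff₀ hd0, ← mul_assoc]
                  exact hsize k (Nat.lt_succ_iff.1 (Finset.mem_range.1 hk))
            _ = M * W := by
                rw [Finset.sum_const, Finset.card_range, nsmul_eq_mul]
                push_cast
                field_simp
      _ = _ := by
          rw [ENNReal.ofReal_mul hM]
          ring
  have hden : Z₀ * a * ENNReal.ofReal W ≤ ∫⁻ β, likelihood σ X r β ∂complexityPrior d w b := by
    rw [lintegral_complexityPrior]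
    refine le_trans ?_ (Finset.single_le_sum
      (f := fun S : Finset (Fin d) => ENNReal.ofReal (w S.card / (d.choose S.card : ℝ)) *
        ∫⁻ β, likelihood σ X r β ∂slab b S) (fun _ _ => zero_le) (Finset.mem_univ (supp βs)))
    have hball : Z₀ * ENNReal.ofReal (Real.exp (-(3 / 2))) *
        ENNReal.ofReal ((l0 βs : ℝ)⁻¹ ^ l0 βs * Real.exp (-b * l1 βs - 1)) ≤
        ∫⁻ β, likelihood σ X r β ∂slab b (supp βs) := by
      refine le_trans ?_ (mul_meas_ge_le_lintegral (measurable_likelihood σ X r)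
        (Z₀ * ENNReal.ofReal (Real.exp (-(3 / 2)))))
      refine mul_le_mul_right ((slab_ball_ge hb βs hs).trans (measure_mono ?_)) _
      intro β hβ
      change _ ≤ likelihood σ X r β
      rw [likelihood_eq_mul hσ X r βs β]
      exact mul_le_mul_right
        (ENNReal.ofReal_le_ofReal (Real.exp_le_exp.2 (hlower _ hβ))) _
    refine le_trans (le_of_eq ?_) (mul_le_mul_right hball _)
    have hexp : ENNReal.ofReal ((l0 βs : ℝ)⁻¹ ^ l0 βs * Real.exp (-(5 / 2))) * a =
        ENNReal.ofReal (Real.exp (-(3 / 2))) *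
          ENNReal.ofReal ((l0 βs : ℝ)⁻¹ ^ l0 βs * Real.exp (-b * l1 βs - 1)) := by
      rw [ha, ← ENNReal.ofReal_mul (by positivity), ← ENNReal.ofReal_mul (by positivity), mul_assoc,
        ← Real.exp_add, mul_left_comm, ← Real.exp_add]
      congr 3
      ring
    have hwt : 0 ≤ w (l0 βs) / (d.choose (l0 βs) : ℝ) := hweight (supp βs)
    rw [hW, ENNReal.ofReal_mul hwt, mul_assoc Z₀ (ENNReal.ofReal (Real.exp (-(3 / 2)))), ← hexp]
    change _ = ENNReal.ofReal (w (l0 βs) / (d.choose (l0 βs) : ℝ)) * _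
    ring
  rw [posterior, Measure.smul_apply, withDensity_apply _ hB, smul_eq_mul, mul_comm,
    ← div_eq_mul_inv]
  exact ENNReal.div_le_of_le_mul (hnum.trans (mul_le_mul_right hden _))

/-! ### The deterministic contraction bound -/

/-- Sizes above `D` are ruled out by the decay of the weights, which beats the likelihood exponent
`24 f` and the combinatorial factors; sizes below `D` by the likelihood exponent itself. -/
lemma weight_mul_exp_le {d s : ℕ} {A₁ A₂ A₃ A₄ D f : ℝ} {w : ℕ → ℝ}
    (hw : IsSparsityPrior d A₁ A₂ A₃ A₄ w) (hA₂ : 0 ≤ A₂) (hA₃ : 0 ≤ A₃) (hA₄ : 0 < A₄)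
    (hd : 10 ≤ d) (hlog : 3 ≤ Real.log d) (hd1 : (d : ℝ)⁻¹ ≤ A₁)
    (hd2 : 10 * A₂ ≤ (d : ℝ) ^ (A₄ / 2)) (hs : 1 ≤ s) (hsd : s ≤ d) (hf : 0 ≤ f)
    (hD : (1 + 40 / A₄) * s + 128 / A₄ * f ≤ D) {E : ℕ → ℝ}
    (hE1 : ∀ k : ℕ, D < k → E k ≤ 24 * f * Real.log d)
    (hE2 : ∀ k : ℕ, (k : ℝ) ≤ D → E k ≤ -((A₃ + 10) * (D + s) * Real.log d)) {k : ℕ}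
    (hk : k ≤ d) :
    w k * 10 ^ k * Real.exp (E k) * (d + 1) ≤ Real.exp (-(s * Real.log d)) *
      (w s / (d.choose s : ℝ) * ((s : ℝ)⁻¹ ^ s * Real.exp (-(5 / 2)))) := by
  set ℓ := Real.log d with hℓ
  have hd0 : (0 : ℝ) < d := by exact_mod_cast (by omega : 0 < d)
  have hd10 : (10 : ℝ) ≤ d := by exact_mod_cast hd
  have hs1 : (1 : ℝ) ≤ s := by exact_mod_cast hs
  have hws := hw.nonneg s hsd
  have hexp : Real.exp ℓ = d := Real.exp_log hd0
  have hten : ∀ n : ℕ, (10 : ℝ) ^ n ≤ Real.exp (n * ℓ) := fun n => by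
    rw [Real.exp_nat_mul, hexp]
    exact pow_le_pow_left₀ (by norm_num) hd10 n
  have hsℓ : ℓ ≤ s * ℓ := le_mul_of_one_le_left (by linarith) hs1
  have hd1' : (d : ℝ) + 1 ≤ Real.exp (2 * (s * ℓ)) := by
    calc (d : ℝ) + 1 ≤ d * d := by nlinarith
      _ = Real.exp (2 * ℓ) := by rw [two_mul, Real.exp_add, hexp]
      _ ≤ _ := Real.exp_le_exp.2 (by linarith)
  have hchoose : Real.exp (-(s * ℓ)) ≤ (d.choose s : ℝ)⁻¹ := by
    rw [Real.exp_neg, Real.exp_nat_mul, hexp]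
    have hpos : (0 : ℝ) < d.choose s := by exact_mod_cast Nat.choose_pos hsd
    refine inv_anti₀ hpos ?_
    exact_mod_cast Nat.choose_le_pow d s
  have hself : Real.exp (-(s * ℓ)) ≤ (s : ℝ)⁻¹ ^ s := by
    rw [Real.exp_neg, Real.exp_nat_mul, hexp, inv_pow]
    have : (s : ℝ) ≤ d := by exact_mod_cast hsd
    exact inv_anti₀ (by positivity) (pow_le_pow_left₀ (by positivity) this s)
  have hconst : Real.exp (-(s * ℓ)) ≤ Real.exp (-(5 / 2)) := Real.exp_le_exp.2 (by linarith)
  have key : w k * 10 ^ k * Real.exp (E k) ≤ w s * Real.exp (-(6 * (s * ℓ))) := by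
    rcases lt_or_ge D k with h | h
    · have hsk : s ≤ k := by
        have h1 : 0 ≤ 40 / A₄ * s := by positivity
        have h2 : 0 ≤ 128 / A₄ * f := by positivity
        have : (s : ℝ) ≤ k := by linarith
        exact_mod_cast this
      obtain ⟨n, rfl⟩ := Nat.exists_eq_add_of_le hsk
      have hn : 20 * s + 64 * f ≤ A₄ / 2 * n := by
        have h1 : (1 + 40 / A₄) * s + 128 / A₄ * f < s + n := by
          refine hD.trans_lt ?_
          exact_mod_cast h
        have h2 : 40 / A₄ * s + 128 / A₄ * f ≤ n := by linarith
        calc 20 * s + 64 * f = A₄ / 2 * (40 / A₄ * s + 128 / A₄ * f) := by field_simp; ring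
          _ ≤ _ := mul_le_mul_of_nonneg_left h2 (by positivity)
      have hnℓ := mul_le_mul_of_nonneg_right hn (show 0 ≤ ℓ by linarith)
      have h3 := hw.mul_ten_pow_le hA₂ (by omega) hd2 s n hk
      have h4 : 0 ≤ f * ℓ := mul_nonneg hf (by linarith)
      calc w (s + n) * 10 ^ (s + n) * Real.exp (E (s + n))
          = w (s + n) * 10 ^ n * 10 ^ s * Real.exp (E (s + n)) := by rw [pow_add]; ring
        _ ≤ Real.exp (-(A₄ / 2 * n * ℓ)) * w s * Real.exp (s * ℓ) * Real.exp (24 * f * ℓ) := by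
            gcongr
            · exact hten s
            · exact hE1 _ h
        _ = w s * Real.exp (-(A₄ / 2 * n * ℓ) + s * ℓ + 24 * f * ℓ) := by
            rw [Real.exp_add, Real.exp_add]; ring
        _ ≤ _ := mul_le_mul_of_nonneg_left (Real.exp_le_exp.2 (by linarith)) hws
    · have h3 := hw.le_exp_mul hA₂ hA₃ hA₄.le (by omega) hd1 hd2 hsd hk
      have hD0 : 0 ≤ D := (Nat.cast_nonneg k).trans h
      have hkℓ := mul_le_mul_of_nonneg_right h (show 0 ≤ ℓ by linarith)
      have h4 : 0 ≤ A₃ * D * ℓ := mul_nonneg (mul_nonneg hA₃ hD0) (by linarith)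
      have h5 : 0 ≤ D * ℓ := mul_nonneg hD0 (by linarith)
      have h6 : 0 ≤ s * ℓ := by linarith
      calc w k * 10 ^ k * Real.exp (E k)
          ≤ Real.exp ((A₃ + 1) * s * ℓ) * w s * Real.exp (k * ℓ) *
            Real.exp (-((A₃ + 10) * (D + s) * ℓ)) := by
            gcongr
            · exact hten k
            · exact hE2 k h
        _ = w s * Real.exp ((A₃ + 1) * s * ℓ + k * ℓ + -((A₃ + 10) * (D + s) * ℓ)) := by
            rw [Real.exp_add, Real.exp_add]; ring
        _ ≤ _ := mul_le_mul_of_nonneg_left (Real.exp_le_exp.2 (by linarith)) hws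
  calc w k * 10 ^ k * Real.exp (E k) * (d + 1)
      ≤ w s * Real.exp (-(6 * (s * ℓ))) * Real.exp (2 * (s * ℓ)) := by gcongr
    _ = Real.exp (-(s * ℓ)) * (w s * Real.exp (-(s * ℓ)) *
          (Real.exp (-(s * ℓ)) * Real.exp (-(s * ℓ)))) := by
        have : Real.exp (-(6 * (s * ℓ))) * Real.exp (2 * (s * ℓ)) = Real.exp (-(s * ℓ)) *
            Real.exp (-(s * ℓ)) * (Real.exp (-(s * ℓ)) * Real.exp (-(s * ℓ))) := by
          simp only [← Real.exp_add]
          congr 1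
          ring
        rw [mul_assoc, this]
        ring
    _ ≤ _ := by
        rw [div_eq_mul_inv (w s)]
        gcongr

/-- On a bounded design with positive compatibility numbers and controlled noise, the posterior
leaves mass at most `d ^ (-s)` outside the `ℓ₁` ball; no randomness is involved. -/
lemma posterior_far_le {t d : ℕ} {A₁ A₂ A₃ A₄ σ xmax κ lam R : ℝ} {w : ℕ → ℝ}
    (hw : IsSparsityPrior d A₁ A₂ A₃ A₄ w) (hA₂ : 0 ≤ A₂) (hA₃ : 0 ≤ A₃) (hA₄ : 0 < A₄)
    (hd : 10 ≤ d) (hlog : 3 ≤ Real.log d) (hd1 : (d : ℝ)⁻¹ ≤ A₁)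
    (hd2 : 10 * A₂ ≤ (d : ℝ) ^ (A₄ / 2)) (ht : 1 ≤ t) (htd : t ≤ d) (hσ : 0 < σ)
    (hxmax : 0 < xmax) (hκ : 0 < κ) {βs : Vec d} (hs : 1 ≤ l0 βs) {X : Design t d} {r : Vec t}
    (hX : ∀ i j, |X i j| ≤ xmax)
    (hnoise : NoiseControlled σ xmax (fun i => r i - app X βs i) X)
    (hΨ : 0 < Psi (supp βs) (gram X)) (hψ : 1 / (8 * κ) ≤ psiTilde A₄ xmax (supp βs) X ^ 2)
    (hlam1 : 5 / 3 * lamBar xmax t d ≤ lam) (hlam2 : lam ≤ 2 * lamBar xmax t d)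
    (hR : (200 + 5 * A₃) * σ * xmax * κ * (Dstar A₄ xmax (supp βs) X + (supp βs).card) *
      Real.sqrt ((Real.log d + Real.log t) / t) ≤ R) :
    posterior (complexityPrior d w (lam / σ)) σ X r {β | R ≤ l1 fun j => β j - βs j} ≤
      ENNReal.ofReal (Real.exp (-(l0 βs * Real.log d))) := by
  have ht0 : (0 : ℝ) < t := by exact_mod_cast ht
  have hd0 : (0 : ℝ) < d := by exact_mod_cast (by omega : 0 < d)
  set s := l0 βs with hs_def
  have hs1 : (1 : ℝ) ≤ s := by exact_mod_cast hs
  have hcard : (supp βs).card = s := rfl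
  have hS : (supp βs).Nonempty := Finset.card_pos.1 (by omega)
  set φ := phiComp (supp βs) X with hφ_def
  have hΨφ : Psi (supp βs) (gram X) ≤ φ ^ 2 := Psi_le_phiComp_sq hS X
  have hφ : 0 < φ :=
    lt_of_le_of_ne (phiComp_nonneg _ _) fun h => by rw [← h] at hΨφ; linarith
  set D := Dstar A₄ xmax (supp βs) X with hD_def
  set f := xmax ^ 2 * s / φ ^ 2 with hf
  have hf0 : 0 ≤ f := by positivity
  have hD : D = (1 + 40 / A₄) * s + 128 / A₄ * f := by
    rw [hD_def, Dstar, hcard, hf]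
    ring
  have hDs : 0 ≤ D := by rw [hD]; positivity
  have hm : 0 < D + s := by linarith
  set ℓ := Real.log d with hℓ
  set Λ := ℓ + Real.log t with hΛ
  have hlogt : 0 ≤ Real.log t := Real.log_nonneg (by exact_mod_cast ht)
  have hlogtd : Real.log t ≤ ℓ := Real.log_le_log ht0 (by exact_mod_cast htd)
  have hΛ0 : 0 ≤ Λ := by linarith
  -- `lamBar` and the radius both carry `√(t Λ)`.
  set p := Real.sqrt (t * Λ) with hp
  have hp0 : 0 ≤ p := Real.sqrt_nonneg _
  have hp2 : p ^ 2 = t * Λ := Real.sq_sqrt (by positivity)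
  have hbar2 : lamBar xmax t d ^ 2 = 2 * (xmax * p) ^ 2 := by
    rw [lamBar, mul_pow, Real.sq_sqrt (by positivity), mul_pow, hp2]
    ring
  have hbar0 : 0 ≤ lamBar xmax t d := mul_nonneg hxmax.le (Real.sqrt_nonneg _)
  have hxp : 0 ≤ xmax * p := by positivity
  have hbar_ge : xmax * p ≤ lamBar xmax t d := by
    refine le_of_sq_le_sq ?_ hbar0
    rw [hbar2]
    linarith [sq_nonneg (xmax * p)]
  have hbar_le : lamBar xmax t d ≤ 3 / 2 * (xmax * p) := by
    refine le_of_sq_le_sq ?_ (by positivity)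
    rw [hbar2]
    linarith [sq_nonneg (xmax * p)]
  have htlam : t * xmax ^ 2 ≤ lam ^ 2 := by
    have h1 : lamBar xmax t d ^ 2 ≤ lam ^ 2 := pow_le_pow_left₀ hbar0 (by linarith) 2
    have h2 : t * xmax ^ 2 ≤ (xmax * p) ^ 2 := by
      rw [mul_pow, hp2]
      have h3 : (t : ℝ) * 1 ≤ t * Λ := mul_le_mul_of_nonneg_left (by linarith) ht0.le
      have h4 := mul_le_mul_of_nonneg_left h3 (sq_nonneg xmax)
      linarith
    rw [hbar2] at h1
    linarith [sq_nonneg (xmax * p)]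
  have hlam0 : 0 < lam := by
    have hΛ1 : 0 < Λ := by linarith
    have h1 : 0 < p := Real.sqrt_pos.2 (by positivity)
    have h2 : 0 < xmax * p := by positivity
    linarith
  have hlam_sq : lam ^ 2 ≤ 16 * xmax ^ 2 * t * ℓ := by
    have h1 : lam ^ 2 ≤ (2 * lamBar xmax t d) ^ 2 := pow_le_pow_left₀ hlam0.le hlam2 2
    have h2 : 8 * xmax ^ 2 * t * Λ ≤ 8 * xmax ^ 2 * t * (2 * ℓ) :=
      mul_le_mul_of_nonneg_left (by linarith) (by positivity)
    rw [mul_pow 2, hbar2, mul_pow, hp2] at h1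
    linarith
  set b := lam / σ with hb_def
  have hb : 0 < b := by positivity
  have hσb : σ ^ 2 * b = σ * lam := by rw [hb_def]; field_simp
  have hσb2 : σ ^ 2 * b ^ 2 = lam ^ 2 := by rw [hb_def]; field_simp
  have hnz : ∀ v : Vec d, |dot (fun i => r i - app X βs i) (app X v)| ≤
      σ * lamBar xmax t d * l1 v := fun v => hnoise.abs_dot_app_le ht v
  have hL : 5 / 3 * (σ * lamBar xmax t d) ≤ σ ^ 2 * b := by
    rw [hσb]
    have := mul_le_mul_of_nonneg_left hlam1 hσ.le
    linarith
  have hlevel : D + s ≤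
      (2 + 40 / A₄ + 128 / A₄ * xmax ^ 2 / Psi (supp βs) (gram X)) * ((supp βs).card : ℝ) := by
    rw [hcard, hD, hf]
    have h1 : 128 / A₄ * (xmax ^ 2 * s / φ ^ 2) ≤
        128 / A₄ * xmax ^ 2 / Psi (supp βs) (gram X) * s := by
      calc 128 / A₄ * (xmax ^ 2 * s / φ ^ 2) = 128 / A₄ * xmax ^ 2 * s / φ ^ 2 := by ring
        _ ≤ 128 / A₄ * xmax ^ 2 * s / Psi (supp βs) (gram X) :=
            div_le_div_of_nonneg_left (by positivity) hΨ hΨφ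
        _ = _ := by ring
    linarith
  have hDm1 : 1 ≤ D + s := by linarith
  obtain ⟨j₀, -⟩ := hS
  -- `κ` cannot be small: test the sparse eigenvalue on one coordinate.
  have hκx : 1 ≤ 8 * (xmax ^ 2 * κ) := by
    have h1 := hψ.trans (phiTilde_sq_le hX ht j₀ (hDm1.trans hlevel))
    rw [div_le_iff₀ (by positivity)] at h1
    linarith
  have hradius : ∀ v : Vec d, R ≤ l1 v →
      (200 + 5 * A₃) * (σ * xmax * κ * (D + s)) * p ≤ t * l1 v := fun v hv => by
    have h1 : t * Real.sqrt (Λ / t) = p := by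
      rw [hp, show (t : ℝ) * Λ = Λ / t * t ^ 2 by field_simp, Real.sqrt_mul' _ (sq_nonneg _),
        Real.sqrt_sq ht0.le, mul_comm]
    have h2 := mul_le_mul_of_nonneg_left (hR.trans hv) ht0.le
    refine le_trans (le_of_eq ?_) h2
    rw [← h1, hcard]
    ring
  set E : ℕ → ℝ := fun k =>
    if D < k then 3 / 2 * (σ ^ 2 * b ^ 2 * (supp βs).card / (t * φ ^ 2))
    else -((A₃ + 10) * (D + s) * ℓ) with hE
  refine posterior_le (E := E) hσ hb hw.nonneg hs ?_ (Real.exp_pos _).le ?_ ?_ ?_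
  · unfold l1
    exact measurableSet_le measurable_const (by fun_prop)
  · intro k β hβ hk
    rw [hE]
    dsimp only
    split_ifs with hDk
    · exact logRatio_add_le_of_phiComp hσ hb.le ht hφ hL (hnz _)
    · have hsparse : (l0 (fun j => β j - βs j) : ℝ) ≤ D + s := by
        have h1 : (l0 (fun j => β j - βs j) : ℝ) ≤ (l0 β + l0 βs : ℕ) := by
          exact_mod_cast l0_sub_le β βs
        have h2 : (l0 β : ℝ) ≤ k := by exact_mod_cast hk
        push_cast at h1
        linarith
      set v : Vec d := fun j => β j - βs j with hv
      have hquad : t * l1 v ^ 2 ≤ 8 * κ * (D + s) * l2 (app X v) ^ 2 := by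
        have h1 := phiTilde_sq_mul_l1_le X hlevel hsparse
        have h2 : 1 / (8 * κ) * (t * l1 v ^ 2) ≤ (D + s) * l2 (app X v) ^ 2 :=
          (mul_le_mul_of_nonneg_right hψ (by positivity)).trans h1
        rw [div_mul_eq_mul_div, one_mul, div_le_iff₀ (by positivity)] at h2
        linarith
      have hp_le := hradius v hβ
      have hQ : 0 ≤ 200 + 5 * A₃ := by linarith
      have hfar : (200 + 5 * A₃) / 3 * (σ ^ 2 * b * κ * (D + s)) ≤ t * l1 v := by
        refine le_trans ?_ hp_le
        have h1 : lam ≤ 3 * (xmax * p) := by linarith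
        have h2 := mul_le_mul_of_nonneg_left h1
          (show 0 ≤ (200 + 5 * A₃) / 3 * (σ * κ * (D + s)) by positivity)
        rw [hσb]
        linarith
      have hbl : (40 + A₃) * (D + s) * ℓ ≤ b * l1 v := by
        have h1 : xmax * p * 5 / 3 ≤ lam := by linarith
        have h2 : (200 + 5 * A₃) * (xmax * κ * (D + s)) * p * (xmax * p * 5 / 3) ≤
            t * (b * l1 v) := by
          have h3 : (200 + 5 * A₃) * (xmax * κ * (D + s)) * p ≤ t * (l1 v / σ) := by
            rw [← mul_div_assoc, le_div_iff₀ hσ]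
            linarith
          calc _ ≤ t * (l1 v / σ) * lam :=
                mul_le_mul h3 h1 (by positivity)
                  (mul_nonneg ht0.le (div_nonneg (l1_nonneg _) hσ.le))
            _ = _ := by rw [hb_def]; ring
        have h4 : (200 + 5 * A₃) * (xmax * κ * (D + s)) * p * (xmax * p * 5 / 3) =
            t * ((200 + 5 * A₃) * 5 / 24 * (8 * (xmax ^ 2 * κ)) * ((D + s) * Λ)) := by
          linear_combination (200 + 5 * A₃) * (xmax ^ 2 * κ * (D + s)) * 5 / 3 * hp2
        rw [h4] at h2
        refine le_trans ?_ (le_of_mul_le_mul_left h2 ht0)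
        calc (40 + A₃) * (D + s) * ℓ ≤ (200 + 5 * A₃) * 5 / 24 * 1 * ((D + s) * Λ) := by
              rw [mul_assoc]
              refine mul_le_mul (by linarith) ?_ ?_ ?_
              · exact mul_le_mul_of_nonneg_left (by linarith) hm.le
              · exact mul_nonneg hm.le (by linarith)
              · linarith
          _ ≤ _ := by gcongr
      refine (logRatio_add_le_of_sparse hσ hb.le hκ hm hL (hnz v) hquad hfar).trans ?_
      have h5 : (A₃ + 10) * (D + s) * ℓ ≤ (40 + A₃) * (D + s) * ℓ := by
        refine mul_le_mul_of_nonneg_right ?_ (by linarith)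
        exact mul_le_mul_of_nonneg_right (by linarith) hm.le
      have h6 : b * l1 v ≤ ((200 + 5 * A₃) / 3 / 16 - 17 / 10) * (b * l1 v) :=
        le_mul_of_one_le_left (mul_nonneg hb.le (l1_nonneg _)) (by linarith)
      linarith
  · intro v hv
    refine neg_le_logRatio hσ hb hX ?_ (by rw [hσb2]; exact htlam) (hnz v) hv
    have : 0 ≤ σ * lamBar xmax t d := mul_nonneg hσ.le hbar0
    linarith
  · intro k hk
    refine weight_mul_exp_le hw hA₂ hA₃ hA₄ hd hlog hd1 hd2 hs (l0_le βs) hf0 hD.ge ?_ ?_ hk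
    · intro k hDk
      rw [hE]
      dsimp only
      rw [if_pos hDk, hσb2, hcard, hf]
      have h1 : lam ^ 2 * s / (t * φ ^ 2) ≤ 16 * (xmax ^ 2 * s / φ ^ 2) * ℓ := by
        rw [div_le_iff₀ (by positivity)]
        have h2 := mul_le_mul_of_nonneg_right hlam_sq (show (0 : ℝ) ≤ s by linarith)
        refine h2.trans (le_of_eq ?_)
        field_simp
      linarith
    · intro k hDk
      rw [hE]
      dsimp only
      rw [if_neg (not_lt.2 hDk)]

/-! ### Boundedness of the chosen design -/

lemma measurable_chosen {d K T : ℕ} {Ω : Type*} [MeasurableSpace Ω]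
    {x : Fin T → Fin K → Ω → Vec d} {a : Fin T → Ω → Fin K} {τ : Fin T}
    (hx : ∀ i, Measurable (x τ i)) (ha : Measurable (a τ)) : Measurable (chosen x a τ) :=
  (measurable_from_prod_countable_right (f := fun q : Fin K × Ω => x τ q.1 q.2) hx).comp
    (ha.prodMk measurable_id)

/-- The σ-algebra `info` is built from the earlier actions, hence the recursion on the round. -/
lemma IsBandit.measurable_action {d K T : ℕ} {Ω V : Type*} [MeasurableSpace Ω]
    [MeasurableSpace V] {μ : Measure Ω} {βs : Vec d} {σ : ℝ} {P : Fin K → Measure (Vec d)}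
    {x : Fin T → Fin K → Ω → Vec d} {ε : Fin T → Ω → ℝ} {U : Fin T → Ω → V}
    {a : Fin T → Ω → Fin K} (hrun : IsBandit μ βs σ P x ε U a) (τ : Fin T) :
    Measurable (a τ) := by
  induction τ using WellFoundedLT.induction with
  | ind τ ih =>
    refine (hrun.adapted τ).mono ?_ le_rfl
    refine sup_le (sup_le (iSup_le fun ρ => ?_) (iSup_le fun i => (hrun.measurable_x τ i).comap_le))
      (hrun.measurable_U τ).comap_le
    have hc : Measurable (chosen x a ρ.1) := measurable_chosen (hrun.measurable_x _) (ih ρ.1 ρ.2)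
    refine sup_le hc.comap_le (Measurable.comap_le ?_)
    have hε := hrun.measurable_ε ρ.1
    unfold reward dot
    fun_prop

/-- The chosen contexts are bounded almost surely, whatever the policy. -/
lemma ae_abs_designUpTo_le {d K T t : ℕ} {Ω V : Type*} [MeasurableSpace Ω] [MeasurableSpace V]
    {μ : Measure Ω} {βs : Vec d} {σ xmax ϑ φu c : ℝ} {P : Fin K → Measure (Vec d)}
    {x : Fin T → Fin K → Ω → Vec d} {ε : Fin T → Ω → ℝ} {U : Fin T → Ω → V}
    {a : Fin T → Ω → Fin K} (hP : ContextAssumptions P xmax ϑ φu c)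
    (hrun : IsBandit μ βs σ P x ε U a) (ht : t ≤ T) :
    ∀ᵐ X ∂(μ.map (designUpTo x a ht)), ∀ i j, |X i j| ≤ xmax := by
  have hmeas : Measurable (designUpTo x a ht) := measurable_pi_lambda _ fun i =>
    measurable_chosen (hrun.measurable_x _) (hrun.measurable_action _)
  have hset : MeasurableSet {X : Design t d | ∀ i j, |X i j| ≤ xmax} := by
    simp only [Set.ofPred_forall]
    exact MeasurableSet.iInter fun i => MeasurableSet.iInter fun j =>
      measurableSet_le (by fun_prop) measurable_const
  rw [ae_map_iff hmeas.aemeasurable hset]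
  have h : ∀ τ i, ∀ᵐ o ∂μ, ∀ j, |x τ i o j| ≤ xmax := fun τ i => by
    have h1 := hP.bounded i
    rw [← hrun.law_x τ i] at h1
    exact ae_of_ae_map (hrun.measurable_x τ i).aemeasurable h1
  filter_upwards [ae_all_iff.2 fun τ => ae_all_iff.2 (h τ)] with o ho i j
  exact ho _ _ j

/-- All dimensions large enough for the asymptotic comparisons with `A₁`, `A₂`, `A₄`. -/
lemma exists_large_dim {A₁ A₄ : ℝ} (A₂ : ℝ) (hA₁ : 0 < A₁) (hA₄ : 0 < A₄) :
    ∃ d₀ : ℕ, ∀ d : ℕ, d₀ ≤ d → 10 ≤ d ∧ 3 ≤ Real.log d ∧ (d : ℝ)⁻¹ ≤ A₁ ∧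
      10 * A₂ ≤ (d : ℝ) ^ (A₄ / 2) := by
  have hcast : Filter.Tendsto (fun n : ℕ => (n : ℝ)) Filter.atTop Filter.atTop :=
    tendsto_natCast_atTop_atTop
  have h1 := (Real.tendsto_log_atTop.comp hcast).eventually_ge_atTop 3
  have h2 := (tendsto_inv_atTop_zero.comp hcast).eventually_le_const hA₁
  have h3 := ((tendsto_rpow_atTop (half_pos hA₄)).comp hcast).eventually_ge_atTop (10 * A₂)
  exact Filter.eventually_atTop.1 ((Filter.eventually_ge_atTop 10).and (h1.and (h2.and h3)))

end SparseBandit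

theorem theorem3 (A₁ A₂ A₃ A₄ : ℝ) (hA₁ : 0 < A₁) (hA₂ : 0 < A₂) (hA₃ : 0 < A₃) (hA₄ : 0 < A₄) :
    ∃ Q M : ℝ, 0 < Q ∧ 0 < M ∧
      ∀ (d K T t s : ℕ) (ht1 : 1 ≤ t) (htT : t ≤ T) (hTd : T ≤ d) (hs : 1 ≤ s)
        (σ xmax ϑ ξ φu C c₉ cε C₁ bmax Δ A : ℝ) (ω : ℝ≥0∞)
        (hσ : 0 < σ) (hxmax : 0 < xmax) (hϑ : 0 < ϑ) (hξ : 0 < ξ) (hC : 2 < C)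
        (hc₉ : 0 < c₉) (hcε : 0 < cε) (hC₁ : 0 < C₁) (hΔ : 0 < Δ) (hA : 0 < A)
        (βs : SparseBandit.Vec d) (hβ0 : SparseBandit.l0 βs = s)
        (hβ1 : SparseBandit.l1 βs ≤ bmax)
        (P : Fin K → Measure (SparseBandit.Vec d))
        (hP : SparseBandit.ContextAssumptions P xmax ϑ φu (C * s))
        (Ω V : Type*) [MeasurableSpace Ω] [MeasurableSpace V]
        (μ : Measure Ω) [IsProbabilityMeasure μ]
        (x : Fin T → Fin K → Ω → SparseBandit.Vec d) (ε : Fin T → Ω → ℝ)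
        (U : Fin T → Ω → V) (a : Fin T → Ω → Fin K)
        (hrun : SparseBandit.IsBandit μ βs σ P x ε U a)
        (hmargin : SparseBandit.MarginCondition μ βs x Δ A ω)
        (w : ℕ → ℝ) (hw : SparseBandit.IsSparsityPrior d A₁ A₂ A₃ A₄ w)
        (lam : ℝ) (hlam1 : 5 / 3 * SparseBandit.lamBar xmax t d ≤ lam)
        (hlam2 : lam ≤ 2 * SparseBandit.lamBar xmax t d),
        ∀ᵐ X ∂(μ.map (SparseBandit.designUpTo x a htT)),
          ∫⁻ r, SparseBandit.outsideMass (SparseBandit.complexityPrior d w (lam / σ)) βs σ xmax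
              (SparseBandit.radius Q σ xmax K ξ A₄ (SparseBandit.supp βs) X)
              (SparseBandit.goodDesign K A₄ xmax ξ ϑ φu C c₉ cε C₁ (SparseBandit.supp βs)) X r
            ∂(condDistrib (SparseBandit.rewardsUpTo βs x a ε htT)
                (SparseBandit.designUpTo x a htT) μ X)
          ≤ ENNReal.ofReal (M * (d : ℝ) ^ (-(s : ℝ))) := by

  obtain ⟨d₀, hd₀⟩ := SparseBandit.exists_large_dim A₂ hA₁ hA₄
  refine ⟨200 + 5 * A₃, max 1 ((d₀ : ℝ) ^ d₀), by positivity, by positivity, ?_⟩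
  intro d K T t s ht1 htT hTd hs σ xmax ϑ ξ φu C c₉ cε C₁ bmax Δ A ω hσ hxmax hϑ hξ hC hc₉ hcε hC₁
    hΔ hA βs hβ0 hβ1 P hP Ω V _ _ μ _ x ε U a hrun hmargin w hw lam hlam1 hlam2
  have hsd : s ≤ d := hβ0 ▸ SparseBandit.l0_le βs
  have hd0 : (0 : ℝ) < d := by exact_mod_cast (by omega : 0 < d)
  obtain ⟨o⟩ : Nonempty Ω := nonempty_of_isProbabilityMeasure μ
  have hK : 0 < K := (Nat.zero_le _).trans_lt (a ⟨0, by omega⟩ o).isLt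
  have hK0 : (0 : ℝ) < K := by exact_mod_cast hK
  filter_upwards [SparseBandit.ae_abs_designUpTo_le hP hrun htT] with X hX
  -- The bound holds for every reward vector, so the conditional law of the rewards is irrelevant.
  suffices h : ∀ r, SparseBandit.outsideMass (SparseBandit.complexityPrior d w (lam / σ)) βs σ xmax
      (SparseBandit.radius (200 + 5 * A₃) σ xmax K ξ A₄ (SparseBandit.supp βs) X)
      (SparseBandit.goodDesign K A₄ xmax ξ ϑ φu C c₉ cε C₁ (SparseBandit.supp βs)) X r ≤
      ENNReal.ofReal (max 1 ((d₀ : ℝ) ^ d₀) * (d : ℝ) ^ (-(s : ℝ))) by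
    refine (lintegral_mono h).trans ?_
    rw [lintegral_const, measure_univ, mul_one]
  intro r
  unfold SparseBandit.outsideMass
  split_ifs with hG
  swap
  · exact zero_le
  obtain ⟨⟨-, -, hΨ, hψ⟩, hnoise⟩ := hG
  by_cases hd : d₀ ≤ d
  · obtain ⟨h10, hlog, hd1, hd2⟩ := hd₀ d hd
    have h := SparseBandit.posterior_far_le (κ := K * ξ) hw hA₂.le hA₃.le hA₄ h10 hlog hd1 hd2 ht1
      (htT.trans hTd) hσ hxmax (by positivity) (hβ0.symm ▸ hs) hX hnoise
      (lt_of_lt_of_le (by positivity) hΨ) (by rwa [← mul_assoc]) hlam1 hlam2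
      (R := SparseBandit.radius (200 + 5 * A₃) σ xmax K ξ A₄ (SparseBandit.supp βs) X)
      (by rw [SparseBandit.radius]; exact le_of_eq (by ring))
    refine h.trans (ENNReal.ofReal_le_ofReal ?_)
    rw [hβ0, Real.rpow_def_of_pos hd0, mul_neg, mul_comm (Real.log d)]
    exact le_mul_of_one_le_left (Real.exp_pos _).le (le_max_left _ _)
  · -- In small dimensions the right-hand side is at least one.
    refine (SparseBandit.posterior_le_one _ _ _ _ _).trans (ENNReal.one_le_ofReal.2 ?_)
    rw [Real.rpow_neg hd0.le, Real.rpow_natCast, ← div_eq_mul_inv, one_le_div (by positivity)]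
    refine le_trans ?_ (le_max_right _ _)
    have h1 : (d : ℝ) ≤ d₀ := by exact_mod_cast (not_le.1 hd).le
    have h2 : (1 : ℝ) ≤ d₀ := by exact_mod_cast (by omega : 1 ≤ d₀)
    exact (pow_le_pow_left₀ hd0.le h1 s).trans (pow_le_pow_right₀ h2 (by omega))
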